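/- Let $n\ge 2$. A continuous map $f:U\to\mathbb{R}^n$ on a domain $U\subset\mathbb{R}^n$ is quasiregular if $f\in W^1_{n,\mathrm{loc}}(U)$ and there is $C\in[1,\infty)$ with $\|f'(x)\|^n\le C\,J_f(x)$ for a.e. $x\in U$ ($f'$ the weak derivative, $J_f=\det f'$, $\|\cdot\|$ the operator norm); it is quasiconformal if it is also injective. For $K\ge 1$ and an angle $\varphi$ put $\sigma_K(\varphi)=\dfrac{K}{\sqrt{K^2+(1-K^2)\cos^2\varphi}}$. For $y\in\mathbb{R}^n\setminus\{0\}$ let $\varphi(y)=\cos^{-1}(y_n/|y|)$. The radial stretch by $K$ in the $y_n$-direction is $R(y)=R_K(y)=\sigma_K(\varphi(y))\,y$, $R(0)=0$. For $K,L\ge1$ and $s<t$, the interpolation map on the shell $\{e^s\le|y|\le e^t\}$ is $$R_I(y)=\sigma_K(\varphi(y))^{\nu}\,\sigma_L(\varphi(y))^{1-\nu}\,y,\qquad \nu=\frac{\ln|y|-s}{t-s}.$$ For $x'=(x_1,\dots,x_{n-1})\in[-\pi/2,\pi/2]^{n-1}$ let $M(x')=\max_i|x_i|$ and $h(x')=\left(\frac{x_1\sin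 M}{|x'|},\dots,\frac{x_{n-1}\sin M}{|x'|},\cos M\right)$ with $M=M(x')$, $h(0)=(0,\dots,0,1)$. Extend $h$ to $\mathbb{R}^{n-1}$ by reflections: reflecting in a face of a cube $\pi k+[-\pi/2,\pi/2]^{n-1}$, $k\in\mathbb{Z}^{n-1}$, changes the sign of the last coordinate of $h$; extend $M$ so as to be invariant under these reflections. Let $\mathcal{Z}(x)=e^{x_n}h(x_1,\dots,x_{n-1})$ be the Zorich map, with fundamental set $$B=\left([-\tfrac{\pi}{2},\tfrac{\pi}{2}]^{n-1}\cup(\tfrac{\pi}{2},\tfrac{3\pi}{2})\times(-\tfrac{\pi}{2},\tfrac{\pi}{2})^{n-2}\right)\times\mathbb{R},$$ which $\mathcal{Z}$ maps bijectively onto $\mathbb{R}^n\setminus\{0\}$, and let $\tilde f=\mathcal{Z}^{-1}\circ f\circ\mathcal{Z}$, with $\mathcal{Z}^{-1}$ taking values in $B$, be the Zorich transform of $f$. For $1\le i\le n-1$ let $A_i$ be the set of interior points $x$ of $B$ at which, after reflecting $x'$ into $[-\pi/2,\pi/2]^{n-1}$, $|x_i|>|x_j|$ for all $j\le n-1$,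 $j\ne i$. Put $$H(K,L)=\sqrt{\tfrac54+(K^2+L^2)^2+3(K^2+L^2)}\;(1+K^2+L^2).$$ (a) For every $K\ge1$, $R:\mathbb{R}^n\to\mathbb{R}^n$ is quasiconformal. Its Zorich transform maps $B$ into $B$, satisfies $\mathcal{Z}\circ\tilde R=R\circ\mathcal{Z}$ on $B$, and is given there by $\tilde R(x)=(x_1,\dots,x_{n-1},x_n+\ln\sigma_K(M(x')))$. On every $A_i$ it is differentiable with invertible derivative $A=\tilde R'(x)$ satisfying $\|A\|\|A^{-1}\|\le H(K,1)$, and $\tilde R$ is quasiconformal on the interior of $B$. (b) Let $K,L\ge1$, $s<t$ and $|\ln(K/L)|<\frac{t-s}{2}$. Then $R_I$ is continuous and injective on the closed shell $\{e^s\le|y|\le e^t\}$ and quasiconformal on its interior, and it equals $R_L$ on $|y|=e^s$ and $R_K$ on $|y|=e^t$. On $\{x\in B: s\le x_n\le t\}$ its Zorich transform takes values in $B$, satisfies $\mathcal{Z}\circ\tilde R_I=R_I\circ\mathcal{Z}$, and is given by $$\tilde R_I(x)=\left(x_1,\dots,x_{n-1},\;x_n+\ln\sigma_K(M(x'))\,\frac{x_n-s}{t-s}+\ln\sigma_L(M(x'))\,\frac{x_n-t}{s-t}\right).$$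 On every $A_i\cap\{s<x_n<t\}$ it is differentiable with invertible derivative $A=\tilde R_I'(x)$ satisfying $\|A\|\|A^{-1}\|\le H(K,L)$, and $\tilde R_I$ is quasiconformal on $\{x\in\operatorname{int}B: s<x_n<t\}$. -/

import Mathlib

open Set MeasureTheory
open scoped ENNReal ContDiff

noncomputable section

/-- `G` is the weak (distributional) total derivative of `f` on the open set `U`: integration by
parts holds against every smooth function with compact support in `U`. -/
def HasWeakFDerivOn {n : ℕ} (f : EuclideanSpace ℝ (Fin n) → EuclideanSpace ℝ (Fin n))
    (G : EuclideanSpace ℝ (Fin n) → EuclideanSpace ℝ (Fin n) →L[ℝ] EuclideanSpace ℝ (Fin n))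
    (U : Set (EuclideanSpace ℝ (Fin n))) : Prop :=
  ∀ φ : EuclideanSpace ℝ (Fin n) → ℝ, ContDiff ℝ ∞ φ → HasCompactSupport φ → tsupport φ ⊆ U →
    ∀ v : EuclideanSpace ℝ (Fin n),
      ∫ x, (fderiv ℝ φ x v) • f x = - ∫ x, φ x • G x v

/-- `f` is quasiregular on `U`: `U` is a domain, `f` is continuous on `U`, `f` lies in the Sobolev
space `W^1_{n,loc}(U)`, and its (weak) derivative `G` satisfies `‖G‖ ^ n ≤ C * det G` almost
everywhere on `U`, for some constant `C ≥ 1`. -/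
def IsQuasiregularOn {n : ℕ} (f : EuclideanSpace ℝ (Fin n) → EuclideanSpace ℝ (Fin n))
    (U : Set (EuclideanSpace ℝ (Fin n))) : Prop :=
  IsOpen U ∧ IsConnected U ∧ ContinuousOn f U ∧
  ∃ G : EuclideanSpace ℝ (Fin n) → EuclideanSpace ℝ (Fin n) →L[ℝ] EuclideanSpace ℝ (Fin n),
    HasWeakFDerivOn f G U ∧
    (∀ S ⊆ U, IsCompact S →
      MemLp f (n : ℝ≥0∞) (volume.restrict S) ∧ MemLp G (n : ℝ≥0∞) (volume.restrict S)) ∧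
    ∃ C : ℝ, 1 ≤ C ∧ ∀ᵐ x ∂(volume.restrict U), ‖G x‖ ^ n ≤ C * (G x).det

/-- A quasiconformal map is an injective quasiregular map. -/
def IsQuasiconformalOn {n : ℕ} (f : EuclideanSpace ℝ (Fin n) → EuclideanSpace ℝ (Fin n))
    (U : Set (EuclideanSpace ℝ (Fin n))) : Prop :=
  IsQuasiregularOn f U ∧ InjOn f U

/-! Below the dimension is `n = m + 1`; the first `n - 1` coordinates of `x` are
`x i.castSucc` with `i : Fin m`, and the `n`-th one is `x (Fin.last m)`. -/

/-- The angle between `y` and the `n`-th coordinate axis. -/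
def polarAngle {m : ℕ} (y : EuclideanSpace ℝ (Fin (m + 1))) : ℝ :=
  Real.arccos (y (Fin.last m) / ‖y‖)

/-- The radial factor of the stretch by `K`, at angle `φ` from the `n`-th axis. -/
def stretchFactor (K φ : ℝ) : ℝ :=
  K / √(K ^ 2 + (1 - K ^ 2) * Real.cos φ ^ 2)

/-- The radial stretch map `R` by `K` in the direction of the `n`-th axis. -/
def radialStretch {m : ℕ} (K : ℝ) (y : EuclideanSpace ℝ (Fin (m + 1))) :
    EuclideanSpace ℝ (Fin (m + 1)) :=
  stretchFactor K (polarAngle y) • y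

/-- The parameter `ν = (ln |y| - s) / (t - s)`. -/
def shellParam {m : ℕ} (s t : ℝ) (y : EuclideanSpace ℝ (Fin (m + 1))) : ℝ :=
  (Real.log ‖y‖ - s) / (t - s)

/-- The radial stretch interpolation map `R_I` (stretch by `L` on `|y| = e^s`, by `K` on
`|y| = e^t`). -/
def radialInterp {m : ℕ} (K L s t : ℝ) (y : EuclideanSpace ℝ (Fin (m + 1))) :
    EuclideanSpace ℝ (Fin (m + 1)) :=
  (stretchFactor K (polarAngle y) ^ shellParam s t y *
    stretchFactor L (polarAngle y) ^ (1 - shellParam s t y)) • y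

/-- Reflects a real number into `[-π/2, π/2]` through the points of `π/2 + π ℤ`; it is the
identity on `[-π/2, π/2]`, and `π - u` for `u` in `[π/2, 3π/2]`. -/
def reflectFold (u : ℝ) : ℝ := Real.arcsin (Real.sin u)

/-- The first `n - 1` coordinates of `x`, reflected into the cube `[-π/2, π/2]^(n-1)`. -/
def foldedCoords {m : ℕ} (x : EuclideanSpace ℝ (Fin (m + 1))) : Fin m → ℝ :=
  fun i => reflectFold (x i.castSucc)

/-- `M = max |x_i|` over the first `n - 1` (reflected) coordinates: the sup norm on `Fin m → ℝ`. -/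
def coordMax {m : ℕ} (x : EuclideanSpace ℝ (Fin (m + 1))) : ℝ := ‖foldedCoords x‖

/-- The Zorich map `Z(x) = e^{x_n} h(x_1, …, x_{n-1})`. On the cube `[-π/2, π/2]^(n-1)`,
`h = (x_1 sin M / |x'|, …, x_{n-1} sin M / |x'|, cos M)` with `x' = (x_1, …, x_{n-1})` (and
`h(0) = (0, …, 0, 1)`, which the convention `a / 0 = 0` gives). Elsewhere `h` is the extension by
reflections: each reflection of the cube in one of its faces changes the sign of the last
coordinate; the product of the signs of the `cos x_i` records the parity of the reflections (on the
faces, where it vanishes, `cos M = 0`). -/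
def zorichMap {m : ℕ} (x : EuclideanSpace ℝ (Fin (m + 1))) : EuclideanSpace ℝ (Fin (m + 1)) :=
  Real.exp (x (Fin.last m)) • WithLp.toLp 2 (Fin.snoc (α := fun _ => ℝ)
    (fun i : Fin m => foldedCoords x i * Real.sin (coordMax x) / √(∑ j, foldedCoords x j ^ 2))
    ((∏ i : Fin m, Real.sign (Real.cos (x i.castSucc))) * Real.cos (coordMax x)))

/-- The fundamental set `B` of the Zorich map:
`([-π/2, π/2]^(n-1) ∪ (π/2, 3π/2) × (-π/2, π/2)^(n-2)) × ℝ`. -/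
def zorichDomain (m : ℕ) : Set (EuclideanSpace ℝ (Fin (m + 1))) :=
  {x | (∀ i : Fin m, x i.castSucc ∈ Icc (-(Real.pi / 2)) (Real.pi / 2)) ∨
    (x 0 ∈ Ioo (Real.pi / 2) (3 * Real.pi / 2) ∧
      ∀ i : Fin m, i.castSucc ≠ 0 → x i.castSucc ∈ Ioo (-(Real.pi / 2)) (Real.pi / 2))}

/-- The Zorich transform `Z⁻¹ ∘ f ∘ Z`, where `Z⁻¹` takes its values in `B`. -/
def zorichTransform {m : ℕ}
    (f : EuclideanSpace ℝ (Fin (m + 1)) → EuclideanSpace ℝ (Fin (m + 1)))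
    (x : EuclideanSpace ℝ (Fin (m + 1))) : EuclideanSpace ℝ (Fin (m + 1)) :=
  Function.invFunOn zorichMap (zorichDomain m) (f (zorichMap x))

/-- The pyramid region of `B` (both signs, both cubes of `B`) on which the maximum `M` is attained
at the `i`-th coordinate only. -/
def pyramid {m : ℕ} (i : Fin m) : Set (EuclideanSpace ℝ (Fin (m + 1))) :=
  {x | x ∈ interior (zorichDomain m) ∧
    ∀ j : Fin m, j ≠ i → |foldedCoords x j| < |foldedCoords x i|}

/-- `F` is differentiable at `x` with invertible derivative `A`, and `‖A‖ ‖A⁻¹‖ ≤ H`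
(operator norms). -/
def HasLinearDistortionLE {n : ℕ} (F : EuclideanSpace ℝ (Fin n) → EuclideanSpace ℝ (Fin n))
    (x : EuclideanSpace ℝ (Fin n)) (H : ℝ) : Prop :=
  ∃ A : EuclideanSpace ℝ (Fin n) ≃L[ℝ] EuclideanSpace ℝ (Fin n),
    HasFDerivAt F (A : EuclideanSpace ℝ (Fin n) →L[ℝ] EuclideanSpace ℝ (Fin n)) x ∧
    ‖(A : EuclideanSpace ℝ (Fin n) →L[ℝ] EuclideanSpace ℝ (Fin n))‖ *
      ‖(A.symm : EuclideanSpace ℝ (Fin n) →L[ℝ] EuclideanSpace ℝ (Fin n))‖ ≤ H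

/-- The bound `H₁ H₂` for the linear distortion, with
`H₁ = √(5/4 + (K² + L²)² + 3 (K² + L²))` and `H₂ = 1 + K² + L²`. -/
def distortionBound (K L : ℝ) : ℝ :=
  √(5 / 4 + (K ^ 2 + L ^ 2) ^ 2 + 3 * (K ^ 2 + L ^ 2)) * (1 + K ^ 2 + L ^ 2)

end

open scoped Topology NNReal

/-! Both radial maps have the form `y ↦ exp(g(ln |y|, cos² φ)) y`, where `g = logInterp` is affine
in its first argument; the plain stretch is the case `K = L`. On the fundamental set, `ln |Z(x)| =
x_n` and `cos² φ(Z(x)) = cos² M(x')`, while translating `x` by `c` in the last direction multiplies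
`Z(x)` by `e^c`. The Zorich transform is therefore the vertical shear `x ↦ x + g(x_n, cos² M) e_n`,
once `Z` is known to be injective on `B`.

Radial map and shear are governed by the same algebra: the derivative is a positive multiple of `I +
w ⊗ l`, with `w = y` or `w = e_n`, whose determinant is `1 + l(w)`. Since `cos² φ` is constant along
rays and `M` does not depend on `x_n`, `l(w)` is just the slope `(ln σ_K - ln σ_L) / (t - s)`. It is
at most `1/2` in absolute value because `|ln σ_K - ln σ_L| ≤ |ln (K/L)|` (`abs_logInterpSlope_le`).
So the determinant of `I + w ⊗ l` is at least `1/2`, and the maps are strictly increasing along rays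
and vertical lines, hence injective.

Bounded distortion follows from bounds on `‖l‖ ‖w‖`. The maps are locally Lipschitz, so by
Rademacher's theorem their a.e. derivative exists, and it is the weak derivative. On a pyramid `cos²
M = cos² x_i` is smooth; there `‖l‖² ≤ (K² + L² + 1) / 4`, and the explicit inverse of a rank one
perturbation gives the bound `H`. -/

/-! ### Locally Lipschitz maps and quasiregularity -/

/-- On an open set, a locally Lipschitz map is Lipschitz on a compact neighbourhood of every
compact subset. -/
theorem exists_compact_nhds_lipschitzOnWith {n : ℕ} {F : Type*} [PseudoMetricSpace F]
    {f : EuclideanSpace ℝ (Fin n) → F} {U S : Set (EuclideanSpace ℝ (Fin n))}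
    (hU : IsOpen U) (hf : LocallyLipschitzOn U f) (hS : IsCompact S) (hSU : S ⊆ U) :
    ∃ T ⊆ U, S ⊆ interior T ∧ ∃ C : ℝ≥0, LipschitzOnWith C f T := by
  obtain ⟨T, hT, hST, hTU⟩ := exists_compact_between hS hU hSU
  obtain ⟨C, hC⟩ := (hf.mono hTU).exists_lipschitzOnWith_of_compact hT
  exact ⟨T, hTU, hST, C, hC⟩

/-- The almost everywhere derivative of a Lipschitz function satisfies integration by parts. -/
theorem LipschitzWith.integral_fderiv_smul_eq {n : ℕ} {C : ℝ≥0}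
    {f : EuclideanSpace ℝ (Fin n) → EuclideanSpace ℝ (Fin n)} (hf : LipschitzWith C f)
    {φ : EuclideanSpace ℝ (Fin n) → ℝ} (hφ : ContDiff ℝ ∞ φ) (hc : HasCompactSupport φ)
    (v : EuclideanSpace ℝ (Fin n)) :
    ∫ x, (fderiv ℝ φ x v) • f x = - ∫ x, φ x • fderiv ℝ f x v := by
  obtain ⟨D, hD⟩ := ContDiff.lipschitzWith_of_hasCompactSupport hc hφ (by simp)
  have hdφ : Continuous fun x => fderiv ℝ φ x v :=
    (hφ.continuous_fderiv (by simp)).clm_apply continuous_const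
  have hcdφ : HasCompactSupport fun x => fderiv ℝ φ x v :=
    (hc.fderiv (𝕜 := ℝ)).mono' fun x hx => by
      refine subset_tsupport _ fun h => hx ?_
      simp [h]
  have hint₁ : Integrable fun x => (fderiv ℝ φ x v) • f x :=
    (hdφ.smul hf.continuous).integrable_of_hasCompactSupport hcdφ.smul_right
  have hint₂ : Integrable fun x => φ x • fderiv ℝ f x v := by
    refine (hφ.continuous.integrable_of_hasCompactSupport hc).smul_of_top_left ?_
    refine memLp_top_of_bound ?_ (C * ‖v‖) (.of_forall fun x => ?_)
    · exact (measurable_fderiv_apply_const ℝ f v).aestronglyMeasurable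
    · exact (ContinuousLinearMap.le_opNorm _ _).trans (by
        gcongr; exact norm_fderiv_le_of_lipschitz ℝ hf)
  -- Scalar integration by parts for Lipschitz functions is applied to each coordinate. The
  -- integrability facts let the coordinate projection pass through the vector-valued integrals.
  ext i
  have key := fun (g : EuclideanSpace ℝ (Fin n) → EuclideanSpace ℝ (Fin n))
    (hg : Integrable g) =>
    ((EuclideanSpace.proj (𝕜 := ℝ) i : EuclideanSpace ℝ (Fin n) →L[ℝ] ℝ).integral_comp_comm
      (φ := g) (μ := volume) hg).symm
  have hfi : LipschitzWith (‖(EuclideanSpace.proj (𝕜 := ℝ) i :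
      EuclideanSpace ℝ (Fin n) →L[ℝ] ℝ)‖₊ * C) fun x => f x i :=
    (EuclideanSpace.proj (𝕜 := ℝ) i : EuclideanSpace ℝ (Fin n) →L[ℝ] ℝ).lipschitz.comp hf
  have main := hfi.integral_lineDeriv_mul_eq (μ := volume) hD hc v
  have e₁ : (∫ x, (fderiv ℝ φ x v) • f x) i = ∫ x, fderiv ℝ φ x v * f x i := by
    simpa using key _ hint₁
  have e₂ : (- ∫ x, φ x • fderiv ℝ f x v) i = - ∫ x, φ x * fderiv ℝ f x v i := by
    have : (∫ x, φ x • fderiv ℝ f x v) i = ∫ x, φ x * fderiv ℝ f x v i := by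
      simpa using key _ hint₂
    rw [PiLp.neg_apply, this]
  have e₃ : ∫ x, lineDeriv ℝ (fun x => f x i) x v * φ x = ∫ x, φ x * fderiv ℝ f x v i := by
    refine integral_congr_ae ?_
    filter_upwards [hf.ae_differentiableAt (μ := volume)] with x hx
    have h := ((EuclideanSpace.proj (𝕜 := ℝ) i :
      EuclideanSpace ℝ (Fin n) →L[ℝ] ℝ).hasFDerivAt.comp x hx.hasFDerivAt).hasLineDerivAt v
    rw [mul_comm, show lineDeriv ℝ (fun x => f x i) x v = fderiv ℝ f x v i from h.lineDeriv]
  have e₄ : ∫ x, lineDeriv ℝ φ x (-v) * f x i = - ∫ x, fderiv ℝ φ x v * f x i := by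
    rw [← integral_neg]
    refine integral_congr_ae (.of_forall fun x => ?_)
    have h := ((hφ.differentiable (by simp)) x).hasFDerivAt.hasLineDerivAt (-v)
    simp [h.lineDeriv]
  rw [e₁, e₂, ← e₃, main, e₄, neg_neg]

/-- The almost everywhere derivative of a locally Lipschitz map is its weak derivative. -/
theorem LocallyLipschitzOn.hasWeakFDerivOn {n : ℕ}
    {f : EuclideanSpace ℝ (Fin n) → EuclideanSpace ℝ (Fin n)}
    {U : Set (EuclideanSpace ℝ (Fin n))} (hU : IsOpen U) (hf : LocallyLipschitzOn U f) :
    HasWeakFDerivOn f (fderiv ℝ f) U := by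
  intro φ hφ hc hs v
  obtain ⟨T, -, hT, C, hC⟩ := exists_compact_nhds_lipschitzOnWith hU hf hc hs
  -- Only `f` near `tsupport φ` matters, so `f` may be replaced by a globally Lipschitz extension of
  -- its restriction to `T`.
  obtain ⟨g, hg, hfg⟩ := hC.extend_finite_dimension
  have h₁ : ∫ x, (fderiv ℝ φ x v) • f x = ∫ x, (fderiv ℝ φ x v) • g x := by
    refine integral_congr_ae (.of_forall fun x => ?_)
    by_cases hx : x ∈ tsupport φ
    · simp only [hfg (interior_subset (hT hx))]
    · have : fderiv ℝ φ x = 0 := by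
        by_contra h
        exact hx (support_fderiv_subset ℝ h)
      simp [this]
  have h₂ : ∫ x, φ x • fderiv ℝ f x v = ∫ x, φ x • fderiv ℝ g x v := by
    refine integral_congr_ae (.of_forall fun x => ?_)
    by_cases hx : x ∈ tsupport φ
    · have : f =ᶠ[𝓝 x] g := by
        filter_upwards [isOpen_interior.mem_nhds (hT hx)] with y hy
        exact hfg (interior_subset hy)
      simp only [this.fderiv_eq]
    · simp [image_eq_zero_of_notMem_tsupport hx]
  rw [h₁, h₂]
  exact hg.integral_fderiv_smul_eq hφ hc v

/-- A locally Lipschitz map whose almost everywhere derivative has bounded distortion is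
quasiregular. -/
theorem IsQuasiregularOn.of_locallyLipschitzOn {n : ℕ}
    {f : EuclideanSpace ℝ (Fin n) → EuclideanSpace ℝ (Fin n)}
    {U : Set (EuclideanSpace ℝ (Fin n))} (hU : IsOpen U) (hconn : IsConnected U)
    (hf : LocallyLipschitzOn U f) {C : ℝ} (hC : 1 ≤ C)
    (hd : ∀ᵐ x ∂(volume.restrict U), ‖fderiv ℝ f x‖ ^ n ≤ C * (fderiv ℝ f x).det) :
    IsQuasiregularOn f U := by
  refine ⟨hU, hconn, hf.continuousOn, fderiv ℝ f, hf.hasWeakFDerivOn hU, fun S hSU hS => ?_,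
    C, hC, hd⟩
  have : IsFiniteMeasure (volume.restrict S) := ⟨by simpa using hS.measure_lt_top⟩
  constructor
  · obtain ⟨B, hB⟩ := hS.exists_bound_of_continuousOn (hf.continuousOn.mono hSU)
    refine MemLp.of_bound ((hf.continuousOn.mono hSU).aestronglyMeasurable hS.measurableSet) B ?_
    exact (ae_restrict_iff' hS.measurableSet).2 (.of_forall hB)
  · obtain ⟨T, -, hT, D, hD⟩ := exists_compact_nhds_lipschitzOnWith hU hf hS hSU
    refine MemLp.of_bound (measurable_fderiv ℝ f).aestronglyMeasurable D ?_
    refine (ae_restrict_iff' hS.measurableSet).2 (.of_forall fun x hx => ?_)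
    exact norm_fderiv_le_of_lipschitzOn ℝ (mem_interior_iff_mem_nhds.1 (hT hx)) hD

/-- Quasiregularity on `U` depends only on the values on `U`. -/
theorem IsQuasiregularOn.congr {n : ℕ}
    {f g : EuclideanSpace ℝ (Fin n) → EuclideanSpace ℝ (Fin n)}
    {U : Set (EuclideanSpace ℝ (Fin n))} (hf : IsQuasiregularOn f U) (h : EqOn g f U) :
    IsQuasiregularOn g U := by
  obtain ⟨hU, hconn, hcont, G, hG, hp, hC⟩ := hf
  refine ⟨hU, hconn, hcont.congr h, G, fun φ hφ hc hs v => ?_, fun S hSU hS => ⟨?_, (hp S hSU hS).2⟩,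
    hC⟩
  · rw [← hG φ hφ hc hs v]
    refine integral_congr_ae (.of_forall fun x => ?_)
    by_cases hx : x ∈ tsupport φ
    · simp only [h (hs hx)]
    · have : fderiv ℝ φ x = 0 := by
        by_contra h
        exact hx (support_fderiv_subset ℝ h)
      simp [this]
  · refine (memLp_congr_ae ?_).1 (hp S hSU hS).1
    exact (ae_restrict_iff' hS.measurableSet).2 (.of_forall fun x hx => (h (hSU hx)).symm)

/-- A map which is differentiable away from the origin, with `‖f y‖ ≤ C ‖y‖` and derivative bounded
by `C`, is Lipschitz. -/
theorem lipschitzWith_of_norm_fderiv_le_of_ne_zero {E F : Type*} [NormedAddCommGroup E]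
    [NormedSpace ℝ E] [NormedAddCommGroup F] [NormedSpace ℝ F] {f : E → F} {C : ℝ≥0}
    (hd : ∀ y ≠ 0, DifferentiableAt ℝ f y) (hb : ∀ y ≠ 0, ‖fderiv ℝ f y‖ ≤ C)
    (h0 : ∀ y, ‖f y‖ ≤ C * ‖y‖) : LipschitzWith C f := by
  refine LipschitzWith.of_dist_le_mul fun y z => ?_
  -- The mean value inequality applies unless the segment meets `0`; in that case `‖y‖ + ‖z‖ = dist
  -- y z` and the growth bound suffices.
  by_cases h : (0 : E) ∈ segment ℝ y z
  · calc dist (f y) (f z) ≤ ‖f y‖ + ‖f z‖ := dist_le_norm_add_norm _ _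
      _ ≤ C * (‖y‖ + ‖z‖) := by linarith [h0 y, h0 z]
      _ = C * dist y z := by
        rw [← dist_add_dist_of_mem_segment h, dist_zero_right, dist_zero_left]
  · have hne : ∀ w ∈ segment ℝ y z, w ≠ 0 := fun w hw e => h (e ▸ hw)
    rw [dist_comm, dist_eq_norm, dist_comm, dist_eq_norm]
    exact (convex_segment y z).norm_image_sub_le_of_norm_fderiv_le (fun w hw => hd w (hne w hw))
      (fun w hw => hb w (hne w hw)) (left_mem_segment ℝ y z) (right_mem_segment ℝ y z)

/-! ### Rank one perturbations of the identity -/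

theorem ContinuousLinearMap.det_id_add_smulRight {n : ℕ}
    (l : EuclideanSpace ℝ (Fin n) →L[ℝ] ℝ) (w : EuclideanSpace ℝ (Fin n)) :
    (ContinuousLinearMap.id ℝ (EuclideanSpace ℝ (Fin n)) + l.smulRight w).det = 1 + l w := by
  have h : ((ContinuousLinearMap.id ℝ (EuclideanSpace ℝ (Fin n)) + l.smulRight w :
      EuclideanSpace ℝ (Fin n) →L[ℝ] EuclideanSpace ℝ (Fin n)) :
      EuclideanSpace ℝ (Fin n) →ₗ[ℝ] EuclideanSpace ℝ (Fin n)) =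
      LinearMap.transvection (l : EuclideanSpace ℝ (Fin n) →ₗ[ℝ] ℝ) w := by
    ext; simp [LinearMap.transvection.apply]
  rw [ContinuousLinearMap.det, h]
  exact LinearMap.transvection.det _ _

theorem ContinuousLinearMap.norm_id_add_smulRight_le {E : Type*} [NormedAddCommGroup E]
    [NormedSpace ℝ E] (l : E →L[ℝ] ℝ) (w : E) :
    ‖ContinuousLinearMap.id ℝ E + l.smulRight w‖ ≤ 1 + ‖l‖ * ‖w‖ :=
  (norm_add_le _ _).trans (add_le_add ContinuousLinearMap.norm_id_le (by simp))

/-- The distortion of a conformal multiple of a rank one perturbation of the identity. -/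
theorem ContinuousLinearMap.norm_pow_le_mul_det_of_rank_one {n : ℕ} {c B : ℝ} (hc : 0 ≤ c)
    (l : EuclideanSpace ℝ (Fin n) →L[ℝ] ℝ) (w : EuclideanSpace ℝ (Fin n))
    (hB : ‖l‖ * ‖w‖ ≤ B) (hl : -(1 / 2) ≤ l w) :
    ‖c • (ContinuousLinearMap.id ℝ (EuclideanSpace ℝ (Fin n)) + l.smulRight w)‖ ^ n ≤
      (2 * (1 + B) ^ n) *
        (c • (ContinuousLinearMap.id ℝ (EuclideanSpace ℝ (Fin n)) + l.smulRight w)).det := by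
  have hdet : (c • (ContinuousLinearMap.id ℝ (EuclideanSpace ℝ (Fin n)) + l.smulRight w)).det =
      c ^ n * (1 + l w) := by
    rw [← ContinuousLinearMap.det_id_add_smulRight, ContinuousLinearMap.det,
      ContinuousLinearMap.toLinearMap_smul, LinearMap.det_smul]
    simp [ContinuousLinearMap.det]
  have hB0 : 0 ≤ B := le_trans (by positivity) hB
  rw [hdet, norm_smul, mul_pow, Real.norm_of_nonneg hc]
  -- The factor `2` compensates for `1 + l w ≥ 1/2`.
  calc c ^ n * ‖ContinuousLinearMap.id ℝ (EuclideanSpace ℝ (Fin n)) + l.smulRight w‖ ^ n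
      ≤ c ^ n * (1 + B) ^ n := by
        gcongr
        exact (l.norm_id_add_smulRight_le w).trans (by linarith)
    _ = (2 * (1 + B) ^ n) * (c ^ n * (1 / 2)) := by ring
    _ ≤ (2 * (1 + B) ^ n) * (c ^ n * (1 + l w)) := by gcongr; linarith

/-! ### The logarithm of the stretch factor as a function of `q = cos² φ` -/

/-- `ln σ_K` as a function of `q = cos² φ`. -/
noncomputable def logStretch (K q : ℝ) : ℝ :=
  Real.log K - Real.log (K ^ 2 + (1 - K ^ 2) * q) / 2

/-- The derivative of `logStretch K`. -/
noncomputable def logStretchDeriv (K q : ℝ) : ℝ :=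
  (K ^ 2 - 1) / (2 * (K ^ 2 + (1 - K ^ 2) * q))

/-- The expression equals `1 + (K² - 1)(1 - q)`. -/
theorem one_le_stretch_denom {K q : ℝ} (hK : 1 ≤ K) (hq : q ∈ Icc (0 : ℝ) 1) :
    1 ≤ K ^ 2 + (1 - K ^ 2) * q := by
  nlinarith [hq.1, hq.2, mul_nonneg (sub_nonneg.2 hq.2) (by nlinarith : (0 : ℝ) ≤ K ^ 2 - 1)]

theorem stretchFactor_eq_exp {K φ : ℝ} (hK : 1 ≤ K) :
    stretchFactor K φ = Real.exp (logStretch K (Real.cos φ ^ 2)) := by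
  have h := one_le_stretch_denom hK ⟨sq_nonneg _, Real.cos_sq_le_one φ⟩
  rw [stretchFactor, logStretch, Real.exp_sub, Real.exp_log (by linarith),
    ← Real.log_sqrt (by linarith), Real.exp_log (Real.sqrt_pos.2 (by linarith))]

theorem hasDerivAt_logStretch {K q : ℝ} (hK : 1 ≤ K) (hq : q ∈ Icc (0 : ℝ) 1) :
    HasDerivAt (logStretch K) (logStretchDeriv K q) q := by
  have h := one_le_stretch_denom hK hq
  have h₁ : HasDerivAt (fun q => K ^ 2 + (1 - K ^ 2) * q) (1 - K ^ 2) q := by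
    simpa using ((hasDerivAt_id q).const_mul (1 - K ^ 2)).const_add (K ^ 2)
  refine (((h₁.log (by linarith)).div_const 2).const_sub (Real.log K)).congr_deriv ?_
  rw [logStretchDeriv]
  field_simp
  ring

theorem logStretchDeriv_nonneg {K q : ℝ} (hK : 1 ≤ K) (hq : q ∈ Icc (0 : ℝ) 1) :
    0 ≤ logStretchDeriv K q := by
  have h := one_le_stretch_denom hK hq
  exact div_nonneg (by nlinarith) (by linarith)

theorem logStretchDeriv_le {K q : ℝ} (hK : 1 ≤ K) (hq : q ∈ Icc (0 : ℝ) 1) :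
    logStretchDeriv K q ≤ K ^ 2 / 2 := by
  have h := one_le_stretch_denom hK hq
  rw [logStretchDeriv, div_le_div_iff₀ (by linarith) (by norm_num)]
  nlinarith

/-- The left side is the absolute `u`-derivative of `ln σ_K(u)`. The denominator `K² sin² u + cos²
u` is at least `2K |sin u cos u|`, which gives `(K² - 1) / (2K) ≤ K / 2`. This growth, linear in
`K`, is what the bound `H` rests on. -/
theorem abs_logStretchDeriv_mul_le {K : ℝ} (hK : 1 ≤ K) (u : ℝ) :
    logStretchDeriv K (Real.cos u ^ 2) * |2 * Real.cos u * Real.sin u| ≤ K / 2 := by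
  have h := one_le_stretch_denom hK ⟨sq_nonneg _, Real.cos_sq_le_one u⟩
  have e : K ^ 2 + (1 - K ^ 2) * Real.cos u ^ 2 = (K * Real.sin u) ^ 2 + Real.cos u ^ 2 := by
    linear_combination K ^ 2 * (- Real.sin_sq_add_cos_sq u)
  rw [logStretchDeriv, div_mul_eq_mul_div, div_le_div_iff₀ (by linarith) (by norm_num), e,
    abs_mul, abs_mul, abs_two]
  have h₁ : 0 ≤ |Real.cos u| * |Real.sin u| := by positivity
  have h₂ := sq_nonneg (K * |Real.sin u| - |Real.cos u|)
  have h₃ : (K * |Real.sin u| - |Real.cos u|) ^ 2 =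
      (K * Real.sin u) ^ 2 + Real.cos u ^ 2 - 2 * K * (|Real.cos u| * |Real.sin u|) := by
    rw [sub_sq, mul_pow, mul_pow, sq_abs, sq_abs]; ring
  nlinarith [mul_nonneg (by linarith : (0 : ℝ) ≤ K) (h₃ ▸ h₂)]

theorem logStretch_le {K q : ℝ} (hK : 1 ≤ K) (hq : q ∈ Icc (0 : ℝ) 1) :
    logStretch K q ≤ Real.log K := by
  have := Real.log_nonneg (one_le_stretch_denom hK hq)
  rw [logStretch]
  linarith

theorem abs_logStretch_sub_le {K q r : ℝ} (hK : 1 ≤ K) (hq : q ∈ Icc (0 : ℝ) 1)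
    (hr : r ∈ Icc (0 : ℝ) 1) : |logStretch K q - logStretch K r| ≤ K ^ 2 / 2 * |q - r| := by
  have := (convex_Icc (0 : ℝ) 1).norm_image_sub_le_of_norm_hasDerivWithin_le
    (f := logStretch K) (f' := logStretchDeriv K) (C := K ^ 2 / 2)
    (fun x hx => (hasDerivAt_logStretch hK hx).hasDerivWithinAt)
    (fun x hx => by
      rw [Real.norm_of_nonneg (logStretchDeriv_nonneg hK hx)]
      exact logStretchDeriv_le hK hx) hr hq
  simpa [Real.norm_eq_abs] using this

/-- Write `D_K = K² + (1 - K²) q`. Then `D_K / K² = 1 - q + q / K²` decreases in `K`, so `ln σ_K`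
increases; `D_K` increases, so `ln K - ln σ_K = (ln D_K) / 2` increases too. -/
theorem logStretch_sub_mem {K L q : ℝ} (hL : 1 ≤ L) (hLK : L ≤ K) (hq : q ∈ Icc (0 : ℝ) 1) :
    logStretch K q - logStretch L q ∈ Icc 0 (Real.log K - Real.log L) := by
  have hK : 1 ≤ K := hL.trans hLK
  have h₁ := one_le_stretch_denom hK hq
  have h₂ := one_le_stretch_denom hL hq
  have hKL : L ^ 2 ≤ K ^ 2 := by gcongr
  have a : Real.log (L ^ 2 + (1 - L ^ 2) * q) ≤ Real.log (K ^ 2 + (1 - K ^ 2) * q) :=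
    Real.log_le_log (by linarith) (by nlinarith [hq.1, hq.2])
  have b : Real.log (L ^ 2 * (K ^ 2 + (1 - K ^ 2) * q)) ≤
      Real.log (K ^ 2 * (L ^ 2 + (1 - L ^ 2) * q)) :=
    Real.log_le_log (by positivity) (by nlinarith [hq.1, hq.2])
  rw [Real.log_mul (by positivity) (by linarith), Real.log_mul (by positivity) (by linarith),
    Real.log_pow, Real.log_pow] at b
  push_cast at b
  simp only [logStretch, mem_Icc]
  constructor <;> linarith

theorem abs_logStretch_sub_le_abs_log {K L q : ℝ} (hK : 1 ≤ K) (hL : 1 ≤ L)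
    (hq : q ∈ Icc (0 : ℝ) 1) : |logStretch K q - logStretch L q| ≤ |Real.log (K / L)| := by
  rw [Real.log_div (by linarith) (by linarith)]
  rcases le_total L K with h | h
  · have := logStretch_sub_mem hL h hq
    rw [abs_of_nonneg this.1]
    exact this.2.trans (le_abs_self _)
  · have := logStretch_sub_mem hK h hq
    rw [abs_sub_comm, abs_of_nonneg this.1, abs_sub_comm]
    exact this.2.trans (le_abs_self _)

/-! ### The interpolated exponent -/

/-- The exponent of the interpolation map, as a function of `τ = ln |y|` and `q = cos² φ`. -/
noncomputable def logInterp (K L s t τ q : ℝ) : ℝ :=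
  logStretch K q * ((τ - s) / (t - s)) + logStretch L q * ((τ - t) / (s - t))

/-- The derivative of `logInterp` in `τ`. -/
noncomputable def logInterpSlope (K L s t q : ℝ) : ℝ :=
  (logStretch K q - logStretch L q) / (t - s)

/-- The derivative of `logInterp` in `q`. -/
noncomputable def logInterpDeriv (K L s t τ q : ℝ) : ℝ :=
  logStretchDeriv K q * ((τ - s) / (t - s)) + logStretchDeriv L q * ((τ - t) / (s - t))

theorem sub_div_sub_comm_eq {s t : ℝ} (hst : s < t) (τ : ℝ) :
    (τ - t) / (s - t) = 1 - (τ - s) / (t - s) := by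
  have h₁ : t - s ≠ 0 := by linarith
  have h₂ : s - t ≠ 0 := by linarith
  field_simp
  ring

theorem logInterp_self {s t : ℝ} (hst : s < t) (K τ q : ℝ) :
    logInterp K K s t τ q = logStretch K q := by
  rw [logInterp, sub_div_sub_comm_eq hst]; ring

theorem logInterpSlope_self (K s t q : ℝ) : logInterpSlope K K s t q = 0 := by
  simp [logInterpSlope]

theorem logInterpDeriv_self {s t : ℝ} (hst : s < t) (K τ q : ℝ) :
    logInterpDeriv K K s t τ q = logStretchDeriv K q := by
  rw [logInterpDeriv, sub_div_sub_comm_eq hst]; ring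

/-- The exponent is affine in `τ`, so the identity is exact and not confined to `[s, t]`. -/
theorem logInterp_sub {s t : ℝ} (hst : s < t) (K L τ τ' q : ℝ) :
    logInterp K L s t τ q - logInterp K L s t τ' q = logInterpSlope K L s t q * (τ - τ') := by
  have h₁ : t - s ≠ 0 := by linarith
  rw [logInterp, logInterp, sub_div_sub_comm_eq hst, sub_div_sub_comm_eq hst, logInterpSlope]
  field_simp
  ring

/-- This is the role of the hypothesis on `ln (K/L)`: it makes `τ ↦ τ + logInterp` increase with
slope at least `1/2`, which yields both injectivity and the determinant bound. -/
theorem abs_logInterpSlope_le {K L s t q : ℝ} (hK : 1 ≤ K) (hL : 1 ≤ L) (hst : s < t)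
    (h : |Real.log (K / L)| < (t - s) / 2) (hq : q ∈ Icc (0 : ℝ) 1) :
    |logInterpSlope K L s t q| ≤ 1 / 2 := by
  have := abs_logStretch_sub_le_abs_log hK hL hq
  rw [logInterpSlope, abs_div, abs_of_pos (by linarith : 0 < t - s), div_le_iff₀ (by linarith)]
  linarith

theorem div_mem_Icc {s t τ : ℝ} (hst : s < t) (hτ : τ ∈ Icc s t) :
    (τ - s) / (t - s) ∈ Icc (0 : ℝ) 1 :=
  ⟨div_nonneg (by linarith [hτ.1]) (by linarith),
    (div_le_one (by linarith)).2 (by linarith [hτ.2])⟩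

/-- The chain rule in a form that serves both `τ = ln |y|` and `τ = x_n`. -/
theorem hasFDerivAt_logInterp {E : Type*} [NormedAddCommGroup E] [NormedSpace ℝ E]
    {K L s t : ℝ} (hK : 1 ≤ K) (hL : 1 ≤ L) (hst : s < t) {τ q : E → ℝ} {τ' q' : E →L[ℝ] ℝ} {x : E}
    (hτ : HasFDerivAt τ τ' x) (hq : HasFDerivAt q q' x) (hqx : q x ∈ Icc (0 : ℝ) 1) :
    HasFDerivAt (fun y => logInterp K L s t (τ y) (q y))
      (logInterpSlope K L s t (q x) • τ' + logInterpDeriv K L s t (τ x) (q x) • q') x := by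
  have hk := (hasDerivAt_logStretch hK hqx).comp_hasFDerivAt x hq
  have hl := (hasDerivAt_logStretch hL hqx).comp_hasFDerivAt x hq
  have h₁ := (hτ.sub_const s).mul_const (t - s)⁻¹
  have h₂ := (hτ.sub_const t).mul_const (s - t)⁻¹
  refine ((hk.mul h₁).add (hl.mul h₂)).congr_fderiv ?_
  ext v
  have e₁ : t - s ≠ 0 := by linarith
  have e₂ : s - t ≠ 0 := by linarith
  simp [logInterpSlope, logInterpDeriv, Function.comp]
  field_simp
  ring

/-- The Lipschitz estimate for the exponent. -/
theorem abs_logInterp_sub_le {K L s t : ℝ} (hK : 1 ≤ K) (hL : 1 ≤ L) (hst : s < t)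
    {τ q r : ℝ} (hτ : τ ∈ Icc s t) (hq : q ∈ Icc (0 : ℝ) 1) (hr : r ∈ Icc (0 : ℝ) 1) :
    |logInterp K L s t τ q - logInterp K L s t τ r| ≤ (K ^ 2 + L ^ 2) / 2 * |q - r| := by
  have hk := abs_logStretch_sub_le hK hq hr
  have hl := abs_logStretch_sub_le hL hq hr
  obtain ⟨h0, h1⟩ := div_mem_Icc hst hτ
  rw [logInterp, logInterp, sub_div_sub_comm_eq hst]
  set ν := (τ - s) / (t - s)
  have e : logStretch K q * ν + logStretch L q * (1 - ν) -
      (logStretch K r * ν + logStretch L r * (1 - ν)) =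
      (logStretch K q - logStretch K r) * ν + (logStretch L q - logStretch L r) * (1 - ν) := by ring
  rw [e]
  refine (abs_add_le _ _).trans ?_
  rw [abs_mul, abs_mul, abs_of_nonneg h0, abs_of_nonneg (by linarith : 0 ≤ 1 - ν)]
  -- Both weights `ν` and `1 - ν` lie in `[0, 1]`; bounding each by `1` gives the sum `(K² + L²) /
  -- 2`.
  nlinarith [mul_le_mul hk h1 h0 (by positivity),
    mul_le_mul hl (by linarith : 1 - ν ≤ 1) (by linarith) (by positivity)]

theorem abs_logInterpDeriv_le {K L s t : ℝ} (hK : 1 ≤ K) (hL : 1 ≤ L) (hst : s < t)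
    {τ q : ℝ} (hτ : τ ∈ Icc s t) (hq : q ∈ Icc (0 : ℝ) 1) :
    |logInterpDeriv K L s t τ q| ≤ (K ^ 2 + L ^ 2) / 2 := by
  obtain ⟨h0, h1⟩ := div_mem_Icc hst hτ
  have hk0 := logStretchDeriv_nonneg hK hq
  have hl0 := logStretchDeriv_nonneg hL hq
  have hk := logStretchDeriv_le hK hq
  have hl := logStretchDeriv_le hL hq
  rw [logInterpDeriv, sub_div_sub_comm_eq hst]
  set ν := (τ - s) / (t - s)
  rw [abs_of_nonneg (add_nonneg (mul_nonneg hk0 h0) (mul_nonneg hl0 (by linarith)))]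
  nlinarith [mul_le_mul hk h1 h0 (by positivity),
    mul_le_mul hl (by linarith : 1 - ν ≤ 1) (by linarith) (by positivity)]

/-- A convex combination of quantities bounded by `K/2` and `L/2` is at most `max K L / 2`, and `max
K L ^ 2 ≤ K² + L²`. -/
theorem sq_logInterpDeriv_mul_le {K L s t : ℝ} (hK : 1 ≤ K) (hL : 1 ≤ L) (hst : s < t)
    {τ : ℝ} (hτ : τ ∈ Icc s t) (u : ℝ) :
    (logInterpDeriv K L s t τ (Real.cos u ^ 2) * (2 * Real.cos u * Real.sin u)) ^ 2 ≤
      (K ^ 2 + L ^ 2) / 4 := by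
  obtain ⟨h0, h1⟩ := div_mem_Icc hst hτ
  have hq : Real.cos u ^ 2 ∈ Icc (0 : ℝ) 1 := ⟨sq_nonneg _, Real.cos_sq_le_one u⟩
  have hk0 := logStretchDeriv_nonneg hK hq
  have hl0 := logStretchDeriv_nonneg hL hq
  have hk := abs_logStretchDeriv_mul_le hK u
  have hl := abs_logStretchDeriv_mul_le hL u
  rw [logInterpDeriv, sub_div_sub_comm_eq hst]
  set ν := (τ - s) / (t - s)
  rw [← sq_abs, abs_mul,
    abs_of_nonneg (add_nonneg (mul_nonneg hk0 h0) (mul_nonneg hl0 (by linarith)))]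
  set z := |2 * Real.cos u * Real.sin u|
  have hz : 0 ≤ z := abs_nonneg _
  have hle : (logStretchDeriv K (Real.cos u ^ 2) * ν +
      logStretchDeriv L (Real.cos u ^ 2) * (1 - ν)) * z ≤ max K L / 2 := by
    have a := mul_le_mul_of_nonneg_right
      (hk.trans (div_le_div_of_nonneg_right (le_max_left K L) zero_le_two)) h0
    have b := mul_le_mul_of_nonneg_right
      (hl.trans (div_le_div_of_nonneg_right (le_max_right K L) zero_le_two))
      (by linarith : 0 ≤ 1 - ν)
    linarith
  have h0' : 0 ≤ (logStretchDeriv K (Real.cos u ^ 2) * ν +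
      logStretchDeriv L (Real.cos u ^ 2) * (1 - ν)) * z :=
    mul_nonneg (add_nonneg (mul_nonneg hk0 h0) (mul_nonneg hl0 (by linarith))) hz
  refine (pow_le_pow_left₀ h0' hle 2).trans ?_
  rcases max_choice K L with h | h <;> rw [h] <;> nlinarith [sq_nonneg K, sq_nonneg L]

/-! ### The radial maps -/

/-- `cos² φ(y)`, the squared cosine of the angle between `y` and the last coordinate axis. -/
noncomputable def axisCosSq {m : ℕ} (y : EuclideanSpace ℝ (Fin (m + 1))) : ℝ :=
  y (Fin.last m) ^ 2 / ‖y‖ ^ 2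

theorem abs_coord_le_norm {m : ℕ} (y : EuclideanSpace ℝ (Fin (m + 1))) (i : Fin (m + 1)) :
    |y i| ≤ ‖y‖ := by
  simpa using PiLp.norm_apply_le y i

theorem axisCosSq_mem_Icc {m : ℕ} (y : EuclideanSpace ℝ (Fin (m + 1))) :
    axisCosSq y ∈ Icc (0 : ℝ) 1 := by
  refine ⟨by rw [axisCosSq]; positivity, ?_⟩
  refine div_le_one_of_le₀ ?_ (sq_nonneg _)
  rw [← sq_abs]
  exact pow_le_pow_left₀ (abs_nonneg _) (abs_coord_le_norm y _) 2

/-- At `y = 0` both sides vanish by the convention `a / 0 = 0`. -/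
theorem cos_polarAngle_sq {m : ℕ} (y : EuclideanSpace ℝ (Fin (m + 1))) :
    Real.cos (polarAngle y) ^ 2 = axisCosSq y := by
  have h : |y (Fin.last m) / ‖y‖| ≤ 1 := by
    rw [abs_div, abs_norm]
    exact div_le_one_of_le₀ (abs_coord_le_norm y _) (norm_nonneg _)
  rw [polarAngle, Real.cos_arccos (abs_le.1 h).1 (abs_le.1 h).2, div_pow, axisCosSq]

theorem axisCosSq_smul {m : ℕ} {c : ℝ} (hc : c ≠ 0) (y : EuclideanSpace ℝ (Fin (m + 1))) :
    axisCosSq (c • y) = axisCosSq y := by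
  rw [axisCosSq, axisCosSq, norm_smul, mul_pow, Real.norm_eq_abs, sq_abs, PiLp.smul_apply,
    smul_eq_mul, mul_pow, mul_div_mul_left _ _ (pow_ne_zero 2 hc)]

theorem radialInterp_eq {m : ℕ} {K L s t : ℝ} (hK : 1 ≤ K) (hL : 1 ≤ L) (hst : s < t)
    (y : EuclideanSpace ℝ (Fin (m + 1))) :
    radialInterp K L s t y =
      Real.exp (logInterp K L s t (Real.log ‖y‖) (axisCosSq y)) • y := by
  rw [radialInterp, stretchFactor_eq_exp hK, stretchFactor_eq_exp hL, cos_polarAngle_sq,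
    ← Real.exp_mul, ← Real.exp_mul, ← Real.exp_add, logInterp, sub_div_sub_comm_eq hst, shellParam]

/-- When the factors agree the weights cancel, on the whole space and for any shell; `0` and `1` are
arbitrary choices. -/
theorem radialStretch_eq_radialInterp {m : ℕ} {K : ℝ} (hK : 1 ≤ K) :
    radialStretch (m := m) K = radialInterp K K 0 1 := by
  funext y
  rw [radialInterp_eq hK hK zero_lt_one, logInterp_self zero_lt_one, radialStretch,
    stretchFactor_eq_exp hK, cos_polarAngle_sq]

theorem radialInterp_of_norm_eq_left {m : ℕ} {K L s t : ℝ}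
    {y : EuclideanSpace ℝ (Fin (m + 1))} (hy : ‖y‖ = Real.exp s) :
    radialInterp K L s t y = radialStretch L y := by
  have h : shellParam s t y = 0 := by simp [shellParam, hy]
  rw [radialInterp, h, Real.rpow_zero, one_mul, sub_zero, Real.rpow_one, radialStretch]

theorem radialInterp_of_norm_eq_right {m : ℕ} {K L s t : ℝ} (hst : s < t)
    {y : EuclideanSpace ℝ (Fin (m + 1))} (hy : ‖y‖ = Real.exp t) :
    radialInterp K L s t y = radialStretch K y := by
  have h : shellParam s t y = 1 := by
    rw [shellParam, hy, Real.log_exp, div_self (by linarith)]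
  rw [radialInterp, h, Real.rpow_one, sub_self, Real.rpow_zero, mul_one, radialStretch]

/-- The derivative of `ln |y|`. -/
theorem hasFDerivAt_log_norm {m : ℕ} {y : EuclideanSpace ℝ (Fin (m + 1))} (hy : y ≠ 0) :
    HasFDerivAt (fun y : EuclideanSpace ℝ (Fin (m + 1)) => Real.log ‖y‖)
      ((‖y‖ ^ 2)⁻¹ • innerSL ℝ y) y := by
  have h : (fun y : EuclideanSpace ℝ (Fin (m + 1)) => Real.log ‖y‖) =
      fun y => Real.log (‖y‖ ^ 2) * 2⁻¹ := by
    funext y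
    rw [Real.log_pow]; push_cast; ring
  have hy' : ‖y‖ ^ 2 ≠ 0 := by simpa using hy
  rw [h]
  refine (((hasStrictFDerivAt_norm_sq y).hasFDerivAt.log hy').mul_const 2⁻¹).congr_fderiv ?_
  ext v
  simp
  ring

/-- Homogeneity of degree `0` makes the derivative vanish in the radial direction and decay like `1
/ ‖y‖`. The constant `4` comes from two terms, each of norm at most `2 / ‖y‖`. -/
theorem exists_hasFDerivAt_axisCosSq {m : ℕ} {y : EuclideanSpace ℝ (Fin (m + 1))} (hy : y ≠ 0) :
    ∃ q' : EuclideanSpace ℝ (Fin (m + 1)) →L[ℝ] ℝ,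
      HasFDerivAt axisCosSq q' y ∧ ‖q'‖ * ‖y‖ ≤ 4 ∧ q' y = 0 := by
  have hy' : ‖y‖ ^ 2 ≠ 0 := by simpa using hy
  have hpos : 0 < ‖y‖ := norm_pos_iff.2 hy
  let p : EuclideanSpace ℝ (Fin (m + 1)) →L[ℝ] ℝ := EuclideanSpace.proj (Fin.last m)
  have hp : HasFDerivAt (fun y : EuclideanSpace ℝ (Fin (m + 1)) => y (Fin.last m)) p y :=
    p.hasFDerivAt
  refine ⟨(2 * y (Fin.last m) / ‖y‖ ^ 2) • p -
    (2 * y (Fin.last m) ^ 2 / ‖y‖ ^ 4) • innerSL ℝ y, ?_, ?_, ?_⟩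
  · refine ((hp.pow 2).mul ((hasDerivAt_inv hy').comp_hasFDerivAt y
      (hasStrictFDerivAt_norm_sq y).hasFDerivAt)).congr_fderiv ?_
    ext v
    simp [p]
    field_simp
    ring
  · rw [← le_div_iff₀ hpos]
    refine ContinuousLinearMap.opNorm_le_bound _ (by positivity) fun v => ?_
    have hyl := abs_coord_le_norm y (Fin.last m)
    have hvl := abs_coord_le_norm v (Fin.last m)
    have hi := abs_real_inner_le_norm y v
    have e : ((2 * y (Fin.last m) / ‖y‖ ^ 2) • p -
        (2 * y (Fin.last m) ^ 2 / ‖y‖ ^ 4) • innerSL ℝ y) v =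
        (2 * y (Fin.last m) * v (Fin.last m) * ‖y‖ ^ 2 -
          2 * y (Fin.last m) ^ 2 * inner ℝ y v) / ‖y‖ ^ 4 := by
      simp [p]
      field_simp
    rw [e, Real.norm_eq_abs, abs_div, abs_of_pos (by positivity : 0 < ‖y‖ ^ 4),
      div_mul_eq_mul_div, div_le_div_iff₀ (by positivity) hpos]
    have h₁ : |2 * y (Fin.last m) * v (Fin.last m) * ‖y‖ ^ 2 -
        2 * y (Fin.last m) ^ 2 * inner ℝ y v| ≤
        2 * ‖y‖ * ‖v‖ * ‖y‖ ^ 2 + 2 * ‖y‖ ^ 2 * (‖y‖ * ‖v‖) := by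
      refine (abs_sub _ _).trans ?_
      simp only [abs_mul, abs_pow, abs_two, abs_norm]
      gcongr
    calc _ ≤ (2 * ‖y‖ * ‖v‖ * ‖y‖ ^ 2 + 2 * ‖y‖ ^ 2 * (‖y‖ * ‖v‖)) * ‖y‖ := by gcongr
      _ = 4 * ‖v‖ * ‖y‖ ^ 4 := by ring
  · simp [p]
    field_simp
    ring

/-- The derivative of the interpolation map is a positive multiple of a rank one perturbation of
the identity. -/
theorem exists_hasFDerivAt_radialInterp {m : ℕ} {K L s t : ℝ} (hK : 1 ≤ K) (hL : 1 ≤ L)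
    (hst : s < t) {B : ℝ} {y : EuclideanSpace ℝ (Fin (m + 1))} (hy : y ≠ 0)
    (ha : |logInterpSlope K L s t (axisCosSq y)| ≤ 1 / 2)
    (hb : |logInterpDeriv K L s t (Real.log ‖y‖) (axisCosSq y)| ≤ B) :
    ∃ l : EuclideanSpace ℝ (Fin (m + 1)) →L[ℝ] ℝ,
      HasFDerivAt (radialInterp K L s t)
        (Real.exp (logInterp K L s t (Real.log ‖y‖) (axisCosSq y)) •
          (ContinuousLinearMap.id ℝ (EuclideanSpace ℝ (Fin (m + 1))) + l.smulRight y)) y ∧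
      ‖l‖ * ‖y‖ ≤ 1 / 2 + 4 * B ∧ -(1 / 2) ≤ l y := by
  obtain ⟨q', hq', hqn, hqy⟩ := exists_hasFDerivAt_axisCosSq hy
  have hpos : 0 < ‖y‖ := norm_pos_iff.2 hy
  have hl := hasFDerivAt_logInterp (K := K) (L := L) (s := s) (t := t) hK hL hst
    (hasFDerivAt_log_norm hy) hq' (axisCosSq_mem_Icc y)
  -- This is the derivative of the exponent. Since `q' y = 0`, its value at `y` is exactly the
  -- slope.
  refine ⟨logInterpSlope K L s t (axisCosSq y) • (‖y‖ ^ 2)⁻¹ • innerSL ℝ y +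
    logInterpDeriv K L s t (Real.log ‖y‖) (axisCosSq y) • q', ?_, ?_, ?_⟩
  · rw [show radialInterp K L s t = _ from funext (radialInterp_eq (m := m) hK hL hst)]
    refine (hl.exp.smul (hasFDerivAt_id y)).congr_fderiv ?_
    ext v
    simp
    ring
  · refine (mul_le_mul_of_nonneg_right (norm_add_le _ _) hpos.le).trans ?_
    rw [norm_smul, norm_smul, norm_smul, innerSL_apply_norm, norm_inv, norm_pow, norm_norm,
      Real.norm_eq_abs, Real.norm_eq_abs, add_mul]
    have e : |logInterpSlope K L s t (axisCosSq y)| * ((‖y‖ ^ 2)⁻¹ * ‖y‖) * ‖y‖ =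
        |logInterpSlope K L s t (axisCosSq y)| := by
      field_simp
    rw [e, mul_assoc]
    have hB : 0 ≤ B := (abs_nonneg _).trans hb
    nlinarith [mul_le_mul hb hqn (by positivity) hB]
  · have e : (‖y‖ ^ 2)⁻¹ * ‖y‖ ^ 2 = 1 := inv_mul_cancel₀ (by positivity)
    simp [hqy, e]
    have := (abs_le.1 ha).1
    norm_num at this ⊢
    exact this

theorem norm_fderiv_radialInterp_pow_le {m : ℕ} {K L s t : ℝ} (hK : 1 ≤ K) (hL : 1 ≤ L)
    (hst : s < t) {B : ℝ} {y : EuclideanSpace ℝ (Fin (m + 1))} (hy : y ≠ 0)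
    (ha : |logInterpSlope K L s t (axisCosSq y)| ≤ 1 / 2)
    (hb : |logInterpDeriv K L s t (Real.log ‖y‖) (axisCosSq y)| ≤ B) :
    ‖fderiv ℝ (radialInterp K L s t) y‖ ^ (m + 1) ≤
      (2 * (1 + (1 / 2 + 4 * B)) ^ (m + 1)) * (fderiv ℝ (radialInterp K L s t) y).det := by
  obtain ⟨l, hl, hn, hy⟩ := exists_hasFDerivAt_radialInterp hK hL hst hy ha hb
  rw [hl.fderiv]
  exact ContinuousLinearMap.norm_pow_le_mul_det_of_rank_one (Real.exp_pos _).le l y hn hy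

theorem contDiffAt_radialInterp {m : ℕ} {K L s t : ℝ} (hK : 1 ≤ K) (hL : 1 ≤ L)
    (hst : s < t) {y : EuclideanSpace ℝ (Fin (m + 1))} (hy : y ≠ 0) :
    ContDiffAt ℝ 1 (radialInterp K L s t) y := by
  rw [show radialInterp K L s t = _ from funext (radialInterp_eq (m := m) hK hL hst)]
  have hn : ‖y‖ ≠ 0 := norm_ne_zero_iff.2 hy
  have h₁ : ContDiffAt ℝ 1 (fun y : EuclideanSpace ℝ (Fin (m + 1)) => Real.log ‖y‖) y :=
    (contDiffAt_norm ℝ hy).log hn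
  have h₂ : ContDiffAt ℝ 1 (axisCosSq (m := m)) y := by
    refine ContDiffAt.div ?_ ((contDiffAt_norm ℝ hy).pow 2) (pow_ne_zero 2 hn)
    exact ((EuclideanSpace.proj (𝕜 := ℝ) (Fin.last m) :
      EuclideanSpace ℝ (Fin (m + 1)) →L[ℝ] ℝ).contDiff.contDiffAt).pow 2
  have h₃ : ∀ k : ℝ, 1 ≤ k →
      ContDiffAt ℝ 1 (fun y : EuclideanSpace ℝ (Fin (m + 1)) => logStretch k (axisCosSq y)) y := by
    intro k hk
    have := one_le_stretch_denom hk (axisCosSq_mem_Icc y)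
    exact contDiffAt_const.sub
      (((contDiffAt_const.add (contDiffAt_const.mul h₂)).log (by linarith)).div_const 2)
  refine ContDiffAt.smul (ContDiffAt.exp ?_) contDiffAt_id
  exact ((h₃ K hK).mul ((h₁.sub contDiffAt_const).div_const _)).add
    ((h₃ L hL).mul ((h₁.sub contDiffAt_const).div_const _))

/-- Points with equal images lie on a common ray, where `cos² φ` is constant and `ln |y|` is moved
by a strictly increasing affine function. -/
theorem radialInterp_injective {m : ℕ} {K L s t : ℝ} (hK : 1 ≤ K) (hL : 1 ≤ L) (hst : s < t)
    (ha : ∀ q ∈ Icc (0 : ℝ) 1, |logInterpSlope K L s t q| ≤ 1 / 2) :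
    Function.Injective (radialInterp (m := m) K L s t) := by
  intro y z h
  rw [radialInterp_eq hK hL hst, radialInterp_eq hK hL hst] at h
  set a := logInterp K L s t (Real.log ‖y‖) (axisCosSq y) with ha'
  set b := logInterp K L s t (Real.log ‖z‖) (axisCosSq z) with hb'
  have hz : z = Real.exp (a - b) • y := by
    rw [Real.exp_sub, div_eq_inv_mul, mul_smul, h, smul_smul,
      inv_mul_cancel₀ (Real.exp_pos _).ne', one_smul]
  by_cases hy : y = 0
  · rw [hz, hy, smul_zero]
  have hq : axisCosSq z = axisCosSq y := by rw [hz, axisCosSq_smul (Real.exp_pos _).ne']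
  have hlog : Real.log ‖z‖ = (a - b) + Real.log ‖y‖ := by
    rw [hz, norm_smul, Real.norm_of_nonneg (Real.exp_pos _).le,
      Real.log_mul (Real.exp_pos _).ne' (norm_ne_zero_iff.2 hy), Real.log_exp]
  have hsub := logInterp_sub hst K L (Real.log ‖y‖) (Real.log ‖z‖) (axisCosSq y)
  rw [← ha', ← hq, ← hb', hq, hlog] at hsub
  have hs := abs_le.1 (ha _ (axisCosSq_mem_Icc y))
  have : (a - b) * (1 + logInterpSlope K L s t (axisCosSq y)) = 0 := by
    linear_combination hsub
  have : a - b = 0 := by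
    rcases mul_eq_zero.1 this with h | h
    · exact h
    · linarith [hs.1]
  rw [hz, this, Real.exp_zero, one_smul]

/-! ### Quasiconformality of the radial maps -/

/-- The shell is the image of an interval times the unit sphere, which is connected in dimension at
least two. -/
theorem isConnected_shell {m : ℕ} (hm : 1 ≤ m) {s t : ℝ} (hst : s < t) :
    IsConnected {y : EuclideanSpace ℝ (Fin (m + 1)) | Real.exp s < ‖y‖ ∧ ‖y‖ < Real.exp t} := by
  have hrank : 1 < Module.rank ℝ (EuclideanSpace ℝ (Fin (m + 1))) := by
    rw [← Module.finrank_eq_rank, finrank_euclideanSpace_fin]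
    exact_mod_cast (by omega : 1 < m + 1)
  have h₁ := isConnected_sphere hrank (0 : EuclideanSpace ℝ (Fin (m + 1))) zero_le_one
  have h₂ : IsConnected (Ioo (Real.exp s) (Real.exp t)) := isConnected_Ioo (Real.exp_lt_exp.2 hst)
  have h₃ := (h₂.prod h₁).image (fun p : ℝ × EuclideanSpace ℝ (Fin (m + 1)) => p.1 • p.2)
    (by fun_prop)
  convert h₃ using 1
  ext y
  constructor
  · intro hy
    have hpos : 0 < ‖y‖ := (Real.exp_pos s).trans hy.1
    refine ⟨(‖y‖, ‖y‖⁻¹ • y), ⟨hy, ?_⟩, ?_⟩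
    · simp [norm_smul, hpos.ne']
    · simp [smul_smul, hpos.ne']
  · rintro ⟨⟨r, u⟩, ⟨hr, hu⟩, rfl⟩
    have hpos : 0 < r := (Real.exp_pos s).trans hr.1
    have hu' : ‖u‖ = 1 := by simpa using hu
    simpa [norm_smul, hu', abs_of_pos hpos] using hr

theorem isQuasiconformalOn_radialInterp {m : ℕ} (hm : 1 ≤ m) {K L s t : ℝ} (hK : 1 ≤ K)
    (hL : 1 ≤ L) (hst : s < t) (hKL : |Real.log (K / L)| < (t - s) / 2) :
    IsQuasiconformalOn (radialInterp (m := m) K L s t)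
      {y | Real.exp s < ‖y‖ ∧ ‖y‖ < Real.exp t} := by
  have ha : ∀ q ∈ Icc (0 : ℝ) 1, |logInterpSlope K L s t q| ≤ 1 / 2 :=
    fun q hq => abs_logInterpSlope_le hK hL hst hKL hq
  have hne : ∀ y : EuclideanSpace ℝ (Fin (m + 1)), Real.exp s < ‖y‖ → y ≠ 0 := fun y hy =>
    norm_pos_iff.1 ((Real.exp_pos s).trans hy)
  have hopen : IsOpen {y : EuclideanSpace ℝ (Fin (m + 1)) | Real.exp s < ‖y‖ ∧ ‖y‖ < Real.exp t} :=
    (isOpen_lt continuous_const continuous_norm).inter (isOpen_lt continuous_norm continuous_const)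
  refine ⟨.of_locallyLipschitzOn (C := 2 * (1 + (1 / 2 + 4 * ((K ^ 2 + L ^ 2) / 2))) ^ (m + 1))
    hopen (isConnected_shell hm hst) ?_ ?_ ?_, (radialInterp_injective hK hL hst ha).injOn⟩
  · intro y hy
    obtain ⟨C, u, hu, hC⟩ := (contDiffAt_radialInterp hK hL hst (hne y hy.1)).exists_lipschitzOnWith
    exact ⟨C, u, mem_nhdsWithin_of_mem_nhds hu, hC⟩
  · have : 1 ≤ (1 + (1 / 2 + 4 * ((K ^ 2 + L ^ 2) / 2))) ^ (m + 1) :=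
      one_le_pow₀ (by nlinarith [sq_nonneg K, sq_nonneg L])
    linarith
  · refine (ae_restrict_iff' hopen.measurableSet).2 (.of_forall fun y hy => ?_)
    have hpos : 0 < ‖y‖ := (Real.exp_pos s).trans hy.1
    refine norm_fderiv_radialInterp_pow_le hK hL hst (hne y hy.1) (ha _ (axisCosSq_mem_Icc y))
      (abs_logInterpDeriv_le hK hL hst ⟨?_, ?_⟩ (axisCosSq_mem_Icc y))
    · exact ((Real.lt_log_iff_exp_lt hpos).2 hy.1).le
    · exact ((Real.log_lt_iff_lt_exp hpos).2 hy.2).le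

theorem isQuasiconformalOn_radialStretch {m : ℕ} {K : ℝ} (hK : 1 ≤ K) :
    IsQuasiconformalOn (radialStretch (m := m) K) univ := by
  rw [radialStretch_eq_radialInterp hK]
  have ha : ∀ q ∈ Icc (0 : ℝ) 1, |logInterpSlope K K 0 1 q| ≤ 1 / 2 :=
    fun q _ => by rw [logInterpSlope_self]; norm_num
  have hb : ∀ y : EuclideanSpace ℝ (Fin (m + 1)),
      |logInterpDeriv K K 0 1 (Real.log ‖y‖) (axisCosSq y)| ≤ K ^ 2 / 2 := fun y => by
    rw [logInterpDeriv_self zero_lt_one,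
      abs_of_nonneg (logStretchDeriv_nonneg hK (axisCosSq_mem_Icc y))]
    exact logStretchDeriv_le hK (axisCosSq_mem_Icc y)
  have hexp : ∀ y : EuclideanSpace ℝ (Fin (m + 1)),
      Real.exp (logInterp K K 0 1 (Real.log ‖y‖) (axisCosSq y)) ≤ K := fun y => by
    rw [logInterp_self zero_lt_one]
    exact (Real.exp_le_exp.2 (logStretch_le hK (axisCosSq_mem_Icc y))).trans
      (Real.exp_log (by linarith)).le
  -- The scaling factor is at most `K`; the rank one perturbation has norm at most `1 + (1/2 + 4B)`
  -- with `B = K² / 2`. A global Lipschitz bound covers the origin, where no derivative is computed.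
  set D : ℝ := K * (1 + (1 / 2 + 4 * (K ^ 2 / 2)))
  have hD : 0 ≤ D := by positivity
  have hlip : LipschitzWith ⟨D, hD⟩ (radialInterp (m := m) K K 0 1) := by
    refine lipschitzWith_of_norm_fderiv_le_of_ne_zero
      (fun y hy => (contDiffAt_radialInterp hK hK zero_lt_one hy).differentiableAt (by simp))
      (fun y hy => ?_) fun y => ?_
    · obtain ⟨l, hl, hn, -⟩ := exists_hasFDerivAt_radialInterp hK hK zero_lt_one hy
        (ha _ (axisCosSq_mem_Icc y)) (hb y)
      rw [hl.fderiv, norm_smul, Real.norm_of_nonneg (Real.exp_pos _).le]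
      refine mul_le_mul (hexp y) ?_ (norm_nonneg _) (by linarith)
      exact (l.norm_id_add_smulRight_le y).trans (by linarith)
    · rw [radialInterp_eq hK hK zero_lt_one, norm_smul, Real.norm_of_nonneg (Real.exp_pos _).le]
      refine mul_le_mul_of_nonneg_right ((hexp y).trans ?_) (norm_nonneg _)
      exact le_mul_of_one_le_right (by linarith) (by nlinarith [sq_nonneg K])
  refine ⟨.of_locallyLipschitzOn (C := 2 * (1 + (1 / 2 + 4 * (K ^ 2 / 2))) ^ (m + 1))
    isOpen_univ isConnected_univ hlip.locallyLipschitz.locallyLipschitzOn ?_ ?_,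
    (radialInterp_injective hK hK zero_lt_one ha).injOn⟩
  · have : 1 ≤ (1 + (1 / 2 + 4 * (K ^ 2 / 2))) ^ (m + 1) :=
      one_le_pow₀ (by nlinarith [sq_nonneg K])
    linarith
  · rw [Measure.restrict_univ]
    filter_upwards [compl_mem_ae_iff.2 (measure_singleton
      (0 : EuclideanSpace ℝ (Fin (m + 1))))] with y hy
    exact norm_fderiv_radialInterp_pow_le hK hK zero_lt_one hy (ha _ (axisCosSq_mem_Icc y)) (hb y)

/-! ### Folded coordinates -/

theorem abs_reflectFold (u : ℝ) : |reflectFold u| = Real.arcsin |Real.sin u| := by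
  rw [reflectFold]
  rcases le_total 0 (Real.sin u) with h | h
  · rw [abs_of_nonneg h, abs_of_nonneg (Real.arcsin_nonneg.2 h)]
  · rw [abs_of_nonpos h, Real.arcsin_neg, abs_of_nonpos (Real.arcsin_nonpos.2 h)]

theorem sin_abs_reflectFold (u : ℝ) : Real.sin |reflectFold u| = |Real.sin u| := by
  rw [abs_reflectFold, Real.sin_arcsin (by linarith [abs_nonneg (Real.sin u)])
    (Real.abs_sin_le_one u)]

theorem abs_reflectFold_le (u : ℝ) : |reflectFold u| ≤ Real.pi / 2 := by
  rw [abs_reflectFold]; exact Real.arcsin_le_pi_div_two _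

theorem reflectFold_of_mem_Icc {u : ℝ} (hu : u ∈ Icc (-(Real.pi / 2)) (Real.pi / 2)) :
    reflectFold u = u := Real.arcsin_sin hu.1 hu.2

theorem reflectFold_of_mem_Ioo {u : ℝ} (hu : u ∈ Ioo (Real.pi / 2) (3 * Real.pi / 2)) :
    reflectFold u = Real.pi - u := by
  rw [reflectFold, ← Real.sin_pi_sub, Real.arcsin_sin] <;> linarith [hu.1, hu.2]

theorem coordMax_nonneg {m : ℕ} (x : EuclideanSpace ℝ (Fin (m + 1))) : 0 ≤ coordMax x :=
  norm_nonneg _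

theorem coordMax_le {m : ℕ} (x : EuclideanSpace ℝ (Fin (m + 1))) : coordMax x ≤ Real.pi / 2 :=
  (pi_norm_le_iff_of_nonneg (by positivity)).2 fun i => abs_reflectFold_le _

theorem cos_coordMax_nonneg {m : ℕ} (x : EuclideanSpace ℝ (Fin (m + 1))) :
    0 ≤ Real.cos (coordMax x) :=
  Real.cos_nonneg_of_mem_Icc ⟨by linarith [coordMax_nonneg x, Real.pi_pos], coordMax_le x⟩

/-- The maximum of `|sin x_i|` over the first `n - 1` coordinates. -/
noncomputable def sinMax {m : ℕ} (x : EuclideanSpace ℝ (Fin (m + 1))) : ℝ :=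
  ‖fun i : Fin m => Real.sin (x i.castSucc)‖

/-- Sine increases on `[0, π/2]`, so it commutes with the maximum, and `sin |reflectFold u| = |sin
u|`. Folding thus disappears in favour of a function that is visibly Lipschitz everywhere. -/
theorem sin_coordMax {m : ℕ} (x : EuclideanSpace ℝ (Fin (m + 1))) :
    Real.sin (coordMax x) = sinMax x := by
  have h1 : sinMax x ≤ 1 :=
    (pi_norm_le_iff_of_nonneg zero_le_one).2 fun i => Real.abs_sin_le_one _
  have h0 : 0 ≤ sinMax x := norm_nonneg _
  apply le_antisymm
  · rw [← Real.le_arcsin_iff_sin_le ⟨by linarith [coordMax_nonneg x, Real.pi_pos], coordMax_le x⟩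
      ⟨by linarith, h1⟩]
    refine (pi_norm_le_iff_of_nonneg (Real.arcsin_nonneg.2 h0)).2 fun i => ?_
    rw [foldedCoords, Real.norm_eq_abs, abs_reflectFold]
    exact Real.monotone_arcsin (norm_le_pi_norm (fun i : Fin m => Real.sin (x i.castSucc)) i)
  · refine (pi_norm_le_iff_of_nonneg (Real.sin_nonneg_of_nonneg_of_le_pi (coordMax_nonneg x)
      (by linarith [coordMax_le x, Real.pi_pos]))).2 fun i => ?_
    rw [Real.norm_eq_abs, ← sin_abs_reflectFold]
    exact Real.sin_le_sin_of_le_of_le_pi_div_two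
      (by linarith [abs_nonneg (reflectFold (x i.castSucc)), Real.pi_pos]) (coordMax_le x)
      (norm_le_pi_norm (foldedCoords x) i)

theorem sinMax_mem_Icc {m : ℕ} (x : EuclideanSpace ℝ (Fin (m + 1))) : sinMax x ∈ Icc (0 : ℝ) 1 :=
  ⟨norm_nonneg _, by rw [← sin_coordMax]; exact Real.sin_le_one _⟩

theorem cos_coordMax_sq {m : ℕ} (x : EuclideanSpace ℝ (Fin (m + 1))) :
    Real.cos (coordMax x) ^ 2 = 1 - sinMax x ^ 2 := by
  rw [Real.cos_sq', sin_coordMax]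

theorem abs_sinMax_sub_le {m : ℕ} (x y : EuclideanSpace ℝ (Fin (m + 1))) :
    |sinMax x - sinMax y| ≤ ‖x - y‖ := by
  refine (abs_norm_sub_norm_le _ _).trans
    ((pi_norm_le_iff_of_nonneg (norm_nonneg _)).2 fun i => ?_)
  have h := Real.lipschitzWith_sin.dist_le_mul (x i.castSucc) (y i.castSucc)
  rw [NNReal.coe_one, one_mul, Real.dist_eq, Real.dist_eq] at h
  exact h.trans (abs_coord_le_norm (x - y) i.castSucc)

/-! ### The Zorich map on its fundamental set -/

theorem zorichMap_last {m : ℕ} (x : EuclideanSpace ℝ (Fin (m + 1))) :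
    zorichMap x (Fin.last m) = Real.exp (x (Fin.last m)) *
      ((∏ i : Fin m, Real.sign (Real.cos (x i.castSucc))) * Real.cos (coordMax x)) := by
  simp [zorichMap]

theorem zorichMap_castSucc {m : ℕ} (x : EuclideanSpace ℝ (Fin (m + 1))) (i : Fin m) :
    zorichMap x i.castSucc = Real.exp (x (Fin.last m)) *
      (foldedCoords x i * Real.sin (coordMax x) / √(∑ j, foldedCoords x j ^ 2)) := by
  simp [zorichMap]

/-- The cube part of the fundamental set. -/
def zorichCube (m : ℕ) : Set (EuclideanSpace ℝ (Fin (m + 1))) :=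
  {x | ∀ i : Fin m, x i.castSucc ∈ Icc (-(Real.pi / 2)) (Real.pi / 2)}

/-- The reflected open cube of the fundamental set. -/
def zorichReflectedCube (m : ℕ) : Set (EuclideanSpace ℝ (Fin (m + 1))) :=
  {x | x 0 ∈ Ioo (Real.pi / 2) (3 * Real.pi / 2) ∧
      ∀ i : Fin m, i.castSucc ≠ 0 → x i.castSucc ∈ Ioo (-(Real.pi / 2)) (Real.pi / 2)}

theorem foldedCoords_of_mem_cube {m : ℕ} {x : EuclideanSpace ℝ (Fin (m + 1))}
    (hx : x ∈ zorichCube m) (i : Fin m) : foldedCoords x i = x i.castSucc :=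
  reflectFold_of_mem_Icc (hx i)

theorem foldedCoords_of_mem_reflectedCube {m : ℕ} {x : EuclideanSpace ℝ (Fin (m + 1))}
    (hx : x ∈ zorichReflectedCube m) (i : Fin m) :
    foldedCoords x i = if i.castSucc = 0 then Real.pi - x i.castSucc else x i.castSucc := by
  split_ifs with h
  · exact reflectFold_of_mem_Ioo (by rw [h]; exact hx.1)
  · exact reflectFold_of_mem_Icc ⟨(hx.2 i h).1.le, (hx.2 i h).2.le⟩

/-- Inside the cube all signs are `1`. On a face some sign is `0`, but there `M = π/2` and `cos M =
0`. -/
theorem prod_sign_mul_cos_of_mem_cube {m : ℕ} {x : EuclideanSpace ℝ (Fin (m + 1))}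
    (hx : x ∈ zorichCube m) :
    (∏ i : Fin m, Real.sign (Real.cos (x i.castSucc))) * Real.cos (coordMax x) =
      Real.cos (coordMax x) := by
  rcases (coordMax_le x).eq_or_lt with h | h
  · rw [h, Real.cos_pi_div_two, mul_zero]
  · rw [Finset.prod_eq_one fun i _ => ?_, one_mul]
    have hi : |x i.castSucc| < Real.pi / 2 := by
      rw [← foldedCoords_of_mem_cube hx i]
      exact (norm_le_pi_norm (foldedCoords x) i).trans_lt h
    exact Real.sign_of_pos (Real.cos_pos_of_mem_Ioo (abs_lt.1 hi))

theorem prod_sign_of_mem_reflectedCube {m : ℕ} [NeZero m] {x : EuclideanSpace ℝ (Fin (m + 1))}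
    (hx : x ∈ zorichReflectedCube m) :
    (∏ i : Fin m, Real.sign (Real.cos (x i.castSucc))) = -1 := by
  rw [Finset.prod_eq_single 0 (fun i _ hi => ?_) (by simp), Fin.castSucc_zero']
  · exact Real.sign_of_neg (Real.cos_neg_of_pi_div_two_lt_of_lt hx.1.1 (by linarith [hx.1.2]))
  · refine Real.sign_of_pos (Real.cos_pos_of_mem_Ioo (hx.2 i fun h => hi ?_))
    rwa [← Fin.castSucc_zero', Fin.castSucc_inj] at h

theorem cos_coordMax_pos_of_mem_reflectedCube {m : ℕ} {x : EuclideanSpace ℝ (Fin (m + 1))}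
    (hx : x ∈ zorichReflectedCube m) : 0 < Real.cos (coordMax x) := by
  refine Real.cos_pos_of_mem_Ioo ⟨by linarith [coordMax_nonneg x, Real.pi_pos], ?_⟩
  refine (pi_norm_lt_iff (by positivity)).2 fun i => ?_
  rw [foldedCoords_of_mem_reflectedCube hx, Real.norm_eq_abs, abs_lt]
  split_ifs with h
  · rw [h]; constructor <;> linarith [hx.1.1, hx.1.2]
  · exact hx.2 i h

theorem prod_sign_mul_cos_sq {m : ℕ} [NeZero m] {x : EuclideanSpace ℝ (Fin (m + 1))}
    (hx : x ∈ zorichDomain m) :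
    ((∏ i : Fin m, Real.sign (Real.cos (x i.castSucc))) * Real.cos (coordMax x)) ^ 2 =
      Real.cos (coordMax x) ^ 2 := by
  rcases hx with hx | hx
  · rw [prod_sign_mul_cos_of_mem_cube hx]
  · rw [prod_sign_of_mem_reflectedCube hx]; ring

theorem sum_foldedCoords_sq_eq_zero {m : ℕ} {x : EuclideanSpace ℝ (Fin (m + 1))} :
    (∑ j, foldedCoords x j ^ 2) = 0 ↔ coordMax x = 0 := by
  rw [coordMax, norm_eq_zero, Finset.sum_eq_zero_iff_of_nonneg fun i _ => sq_nonneg _]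
  simp [funext_iff]

theorem norm_zorichMap {m : ℕ} [NeZero m] {x : EuclideanSpace ℝ (Fin (m + 1))}
    (hx : x ∈ zorichDomain m) : ‖zorichMap x‖ = Real.exp (x (Fin.last m)) := by
  rw [← sq_eq_sq₀ (norm_nonneg _) (Real.exp_pos _).le, EuclideanSpace.real_norm_sq_eq,
    Fin.sum_univ_castSucc, zorichMap_last, mul_pow _ (_ * _), prod_sign_mul_cos_sq hx]
  simp only [zorichMap_castSucc, mul_pow _ (_ / _), div_pow, mul_pow]
  rw [← Finset.mul_sum, ← Finset.sum_div, ← Finset.sum_mul,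
    Real.sq_sqrt (Finset.sum_nonneg fun i _ => sq_nonneg _)]
  -- For `M = 0` the quotient is `0 / 0 = 0`, and the last coordinate alone carries the norm.
  by_cases h : coordMax x = 0
  · simp [h]
  · rw [mul_div_cancel_left₀ _ (sum_foldedCoords_sq_eq_zero.not.2 h), ← mul_add,
      Real.sin_sq_add_cos_sq, mul_one]

theorem axisCosSq_zorichMap {m : ℕ} [NeZero m] {x : EuclideanSpace ℝ (Fin (m + 1))}
    (hx : x ∈ zorichDomain m) : axisCosSq (zorichMap x) = 1 - sinMax x ^ 2 := by
  rw [axisCosSq, norm_zorichMap hx, zorichMap_last, mul_pow _ (_ * _), prod_sign_mul_cos_sq hx,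
    mul_div_cancel_left₀ _ (pow_ne_zero 2 (Real.exp_pos _).ne'), cos_coordMax_sq]

/-- The axis angle determines `cos² M`, hence `M`. If `M ≠ 0`, the other coordinates determine `x'`
up to a positive factor, and equality of the sup norms makes it `1`. -/
theorem foldedCoords_eq_of_zorichMap_eq {m : ℕ} [NeZero m]
    {x y : EuclideanSpace ℝ (Fin (m + 1))} (hx : x ∈ zorichDomain m) (hy : y ∈ zorichDomain m)
    (h : zorichMap x = zorichMap y) (hlast : x (Fin.last m) = y (Fin.last m)) :
    foldedCoords x = foldedCoords y := by
  have hcos : Real.cos (coordMax x) ^ 2 = Real.cos (coordMax y) ^ 2 := by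
    rw [cos_coordMax_sq, cos_coordMax_sq, ← axisCosSq_zorichMap hx, ← axisCosSq_zorichMap hy, h]
  have hM : coordMax x = coordMax y := by
    refine Real.injOn_cos ⟨coordMax_nonneg x, ?_⟩ ⟨coordMax_nonneg y, ?_⟩
      ((sq_eq_sq₀ (cos_coordMax_nonneg x) (cos_coordMax_nonneg y)).1 hcos)
    · linarith [coordMax_le x, Real.pi_pos]
    · linarith [coordMax_le y, Real.pi_pos]
  by_cases h0 : coordMax x = 0
  · rw [norm_eq_zero.1 (h0 : ‖foldedCoords x‖ = 0),
      norm_eq_zero.1 ((hM ▸ h0 : coordMax y = 0) : ‖foldedCoords y‖ = 0)]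
  have hsin : Real.sin (coordMax x) ≠ 0 := (Real.sin_pos_of_pos_of_lt_pi
    ((coordMax_nonneg x).lt_of_ne' h0) (by linarith [coordMax_le x, Real.pi_pos])).ne'
  have hpos : ∀ z : EuclideanSpace ℝ (Fin (m + 1)), coordMax z ≠ 0 →
      0 < √(∑ j, foldedCoords z j ^ 2) := fun z hz => Real.sqrt_pos.2
    ((Finset.sum_nonneg fun i _ => sq_nonneg _).lt_of_ne' (sum_foldedCoords_sq_eq_zero.not.2 hz))
  have hrx := hpos x h0
  have hry := hpos y (hM ▸ h0)
  set r := √(∑ j, foldedCoords x j ^ 2) with hr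
  set r' := √(∑ j, foldedCoords y j ^ 2) with hr'
  have hprop : foldedCoords x = (r / r') • foldedCoords y := by
    funext i
    have hi := congrArg (fun z : EuclideanSpace ℝ (Fin (m + 1)) => z i.castSucc) h
    simp only [zorichMap_castSucc, hlast, ← hM] at hi
    have hi := mul_left_cancel₀ (Real.exp_pos _).ne' hi
    rw [← hr, ← hr', div_eq_div_iff hrx.ne' hry.ne'] at hi
    rw [Pi.smul_apply, smul_eq_mul, div_mul_eq_mul_div, eq_div_iff hry.ne']
    exact mul_right_cancel₀ hsin (by linear_combination hi)
  have hnorm := congrArg norm hprop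
  rw [norm_smul, Real.norm_of_nonneg (by positivity)] at hnorm
  change coordMax x = r / r' * coordMax y at hnorm
  have : r / r' = 1 := mul_right_cancel₀ (hM ▸ h0) (by rw [← hnorm, one_mul, hM])
  rw [hprop, this, one_smul]

theorem zorichMap_last_nonneg {m : ℕ} {x : EuclideanSpace ℝ (Fin (m + 1))}
    (hx : x ∈ zorichCube m) : 0 ≤ zorichMap x (Fin.last m) := by
  rw [zorichMap_last, prod_sign_mul_cos_of_mem_cube hx]
  exact mul_nonneg (Real.exp_pos _).le (cos_coordMax_nonneg x)

theorem zorichMap_last_neg {m : ℕ} [NeZero m] {x : EuclideanSpace ℝ (Fin (m + 1))}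
    (hx : x ∈ zorichReflectedCube m) : zorichMap x (Fin.last m) < 0 := by
  rw [zorichMap_last, prod_sign_of_mem_reflectedCube hx]
  have := mul_pos (Real.exp_pos (x (Fin.last m))) (cos_coordMax_pos_of_mem_reflectedCube hx)
  linarith

/-- The Zorich map is injective on its fundamental set. -/
theorem injOn_zorichMap {m : ℕ} [NeZero m] : InjOn (zorichMap (m := m)) (zorichDomain m) := by
  intro x hx y hy h
  have hlast : x (Fin.last m) = y (Fin.last m) := by
    rw [← Real.exp_eq_exp, ← norm_zorichMap hx, ← norm_zorichMap hy, h]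
  have hf := foldedCoords_eq_of_zorichMap_eq hx hy h hlast
  ext j
  refine Fin.lastCases hlast (fun i => ?_) j
  have hi := congrFun hf i
  -- The sign of the last coordinate of the image tells the two cubes apart, and folding is
  -- injective on each.
  rcases hx with hx | hx <;> rcases hy with hy | hy
  · rwa [foldedCoords_of_mem_cube hx, foldedCoords_of_mem_cube hy] at hi
  · have h₁ := zorichMap_last_nonneg hx
    rw [h] at h₁
    exact absurd (zorichMap_last_neg hy) h₁.not_gt
  · have h₁ := zorichMap_last_nonneg hy
    rw [← h] at h₁
    exact absurd (zorichMap_last_neg hx) h₁.not_gt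
  · rw [foldedCoords_of_mem_reflectedCube hx, foldedCoords_of_mem_reflectedCube hy] at hi
    split_ifs at hi <;> linarith

/-! ### Vertical translations -/

theorem add_single_last_castSucc {m : ℕ} (x : EuclideanSpace ℝ (Fin (m + 1))) (c : ℝ)
    (i : Fin m) : (x + EuclideanSpace.single (Fin.last m) c) i.castSucc = x i.castSucc := by
  simp

theorem add_single_last_last {m : ℕ} (x : EuclideanSpace ℝ (Fin (m + 1))) (c : ℝ) :
    (x + EuclideanSpace.single (Fin.last m) c) (Fin.last m) = x (Fin.last m) + c := by
  simp

theorem sinMax_add_single_last {m : ℕ} (x : EuclideanSpace ℝ (Fin (m + 1))) (c : ℝ) :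
    sinMax (x + EuclideanSpace.single (Fin.last m) c) = sinMax x := by
  simp only [sinMax, add_single_last_castSucc]

/-- This turns multiplication by a positive factor into vertical translation, and so a radial map
into a shear. -/
theorem zorichMap_add_single_last {m : ℕ} (x : EuclideanSpace ℝ (Fin (m + 1))) (c : ℝ) :
    zorichMap (x + EuclideanSpace.single (Fin.last m) c) = Real.exp c • zorichMap x := by
  have h : foldedCoords (x + EuclideanSpace.single (Fin.last m) c) = foldedCoords x := by
    funext i; rw [foldedCoords, foldedCoords, add_single_last_castSucc]
  simp only [zorichMap, coordMax, h, add_single_last_castSucc, add_single_last_last, smul_smul]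
  rw [← Real.exp_add, add_comm c]

theorem add_single_last_mem_zorichDomain {m : ℕ} [NeZero m]
    {x : EuclideanSpace ℝ (Fin (m + 1))} (hx : x ∈ zorichDomain m) (c : ℝ) :
    x + EuclideanSpace.single (Fin.last m) c ∈ zorichDomain m := by
  simp only [zorichDomain, mem_ofPred_eq] at hx ⊢
  -- As `m ≠ 0`, the coordinate `0` is not the last one, so a vertical translation fixes it.
  simp only [← Fin.castSucc_zero' (n := m)] at hx ⊢
  simpa only [add_single_last_castSucc] using hx

/-- The formula for the Zorich transform of the interpolation map. -/
noncomputable def verticalInterp {m : ℕ} (K L s t : ℝ) (x : EuclideanSpace ℝ (Fin (m + 1))) :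
    EuclideanSpace ℝ (Fin (m + 1)) :=
  x + EuclideanSpace.single (Fin.last m) (logInterp K L s t (x (Fin.last m)) (1 - sinMax x ^ 2))

theorem zorichMap_verticalInterp {m : ℕ} [NeZero m] {K L s t : ℝ} (hK : 1 ≤ K) (hL : 1 ≤ L)
    (hst : s < t) {x : EuclideanSpace ℝ (Fin (m + 1))} (hx : x ∈ zorichDomain m) :
    zorichMap (verticalInterp K L s t x) = radialInterp K L s t (zorichMap x) := by
  rw [verticalInterp, zorichMap_add_single_last, radialInterp_eq hK hL hst, norm_zorichMap hx,
    axisCosSq_zorichMap hx, Real.log_exp]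

/-- The shear stays in `B` and has the required image under `Z`, so injectivity of `Z` on `B`
identifies it; surjectivity is not needed. -/
theorem zorichTransform_radialInterp {m : ℕ} [NeZero m] {K L s t : ℝ} (hK : 1 ≤ K) (hL : 1 ≤ L)
    (hst : s < t) {x : EuclideanSpace ℝ (Fin (m + 1))} (hx : x ∈ zorichDomain m) :
    zorichTransform (radialInterp K L s t) x = verticalInterp K L s t x := by
  rw [zorichTransform, ← zorichMap_verticalInterp hK hL hst hx]
  exact injOn_zorichMap.leftInvOn_invFunOn (add_single_last_mem_zorichDomain hx _)

theorem log_stretchFactor_coordMax {m : ℕ} {K : ℝ} (hK : 1 ≤ K)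
    (x : EuclideanSpace ℝ (Fin (m + 1))) :
    Real.log (stretchFactor K (coordMax x)) = logStretch K (1 - sinMax x ^ 2) := by
  rw [stretchFactor_eq_exp hK, Real.log_exp, cos_coordMax_sq]

/-! ### The interior of the fundamental set -/

/-- The interior of the fundamental set of the Zorich map. -/
def zorichBox (m : ℕ) : Set (EuclideanSpace ℝ (Fin (m + 1))) :=
  {x | ∀ i : Fin m, x i.castSucc ∈
    Ioo (-(Real.pi / 2)) (if i.castSucc = 0 then 3 * Real.pi / 2 else Real.pi / 2)}

theorem isOpen_zorichBox (m : ℕ) : IsOpen (zorichBox m) := by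
  simp only [zorichBox, ofPred_forall]
  exact isOpen_iInter_of_finite fun i => isOpen_Ioo.preimage (by fun_prop)

theorem convex_zorichBox (m : ℕ) : Convex ℝ (zorichBox m) := by
  simp only [zorichBox, ofPred_forall]
  exact convex_iInter fun i => (convex_Ioo _ _).linear_preimage
    (EuclideanSpace.proj (𝕜 := ℝ) i.castSucc :
      EuclideanSpace ℝ (Fin (m + 1)) →L[ℝ] ℝ).toLinearMap

theorem zorichBox_subset (m : ℕ) [NeZero m] : zorichBox m ⊆ zorichDomain m := by
  intro x hx
  have h0 := hx 0
  rw [if_pos Fin.castSucc_zero', Fin.castSucc_zero'] at h0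
  rcases le_or_gt (x 0) (Real.pi / 2) with h | h
  · refine Or.inl fun i => ?_
    by_cases hi : i.castSucc = 0
    · rw [hi]; exact ⟨h0.1.le, h⟩
    · have := hx i
      rw [if_neg hi] at this
      exact Ioo_subset_Icc_self this
  · refine Or.inr ⟨⟨h, h0.2⟩, fun i hi => ?_⟩
    have := hx i
    rwa [if_neg hi] at this

/-- The wall `x_1 = π/2` between the cubes becomes interior, so the interior is one box, convex and
hence connected. For the inclusion in the box, coordinate projections are open and map `B` into the
closed intervals. -/
theorem interior_zorichDomain (m : ℕ) [NeZero m] : interior (zorichDomain m) = zorichBox m := by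
  refine Subset.antisymm (fun x hx i => ?_)
    (interior_maximal (zorichBox_subset m) (isOpen_zorichBox m))
  have hopen : IsOpenMap fun x : EuclideanSpace ℝ (Fin (m + 1)) => x i.castSucc :=
    (EuclideanSpace.proj (𝕜 := ℝ) i.castSucc : EuclideanSpace ℝ (Fin (m + 1)) →L[ℝ] ℝ).isOpenMap
      fun r => ⟨EuclideanSpace.single i.castSucc r, by simp⟩
  rw [← interior_Icc]
  refine interior_mono ?_ (hopen.image_interior_subset _ (mem_image_of_mem _ hx))
  rintro _ ⟨y, hy, rfl⟩
  rcases hy with hy | hy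
  · refine ⟨(hy i).1, (hy i).2.trans ?_⟩
    split_ifs <;> linarith [Real.pi_pos]
  · by_cases hi : i.castSucc = 0
    · simp only [hi, if_true]
      exact ⟨by linarith [hy.1.1, Real.pi_pos], hy.1.2.le⟩
    · simp only [hi, if_false]
      exact Ioo_subset_Icc_self (hy.2 i hi)

theorem isConnected_zorichBox_inter {m : ℕ} {I : Set ℝ} (hI : Convex ℝ I) (hne : I.Nonempty) :
    IsConnected (zorichBox m ∩ {x | x (Fin.last m) ∈ I}) := by
  obtain ⟨τ, hτ⟩ := hne
  refine ⟨⟨EuclideanSpace.single (Fin.last m) τ, fun i => ?_, by simpa using hτ⟩, ?_⟩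
  · have : (EuclideanSpace.single (Fin.last m) τ : EuclideanSpace ℝ (Fin (m + 1))) i.castSucc = 0 := by
      simp
    rw [this]
    split_ifs <;> constructor <;> linarith [Real.pi_pos]
  · exact ((convex_zorichBox m).inter (hI.linear_preimage
      (EuclideanSpace.proj (𝕜 := ℝ) (Fin.last m) :
        EuclideanSpace ℝ (Fin (m + 1)) →L[ℝ] ℝ).toLinearMap)).isPreconnected

/-! ### Quasiconformality of the Zorich transforms -/

theorem one_sub_sinMax_sq_mem_Icc {m : ℕ} (x : EuclideanSpace ℝ (Fin (m + 1))) :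
    1 - sinMax x ^ 2 ∈ Icc (0 : ℝ) 1 := by
  have h := sinMax_mem_Icc x
  constructor <;> nlinarith [h.1, h.2]

theorem abs_sinMax_sq_sub_le {m : ℕ} (x y : EuclideanSpace ℝ (Fin (m + 1))) :
    |(1 - sinMax x ^ 2) - (1 - sinMax y ^ 2)| ≤ 2 * ‖x - y‖ := by
  have hx := sinMax_mem_Icc x
  have hy := sinMax_mem_Icc y
  have e : (1 - sinMax x ^ 2) - (1 - sinMax y ^ 2) =
      (sinMax x + sinMax y) * -(sinMax x - sinMax y) := by ring
  rw [e, abs_mul, abs_neg, abs_of_nonneg (add_nonneg hx.1 hy.1)]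
  exact mul_le_mul (by linarith [hx.2, hy.2]) (abs_sinMax_sub_le x y) (abs_nonneg _) zero_le_two

theorem verticalInterp_injective {m : ℕ} {K L s t : ℝ} (hst : s < t)
    (ha : ∀ q ∈ Icc (0 : ℝ) 1, |logInterpSlope K L s t q| ≤ 1 / 2) :
    Function.Injective (verticalInterp (m := m) K L s t) := by
  intro x y h
  have hi : ∀ i : Fin m, x i.castSucc = y i.castSucc := fun i => by
    have := congrArg (fun z : EuclideanSpace ℝ (Fin (m + 1)) => z i.castSucc) h
    simpa only [verticalInterp, add_single_last_castSucc] using this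
  have hS : sinMax x = sinMax y := by simp only [sinMax, hi]
  have hn := congrArg (fun z : EuclideanSpace ℝ (Fin (m + 1)) => z (Fin.last m)) h
  simp only [verticalInterp, add_single_last_last, hS] at hn
  have hsub := logInterp_sub hst K L (x (Fin.last m)) (y (Fin.last m)) (1 - sinMax y ^ 2)
  have hs := abs_le.1 (ha _ (one_sub_sinMax_sq_mem_Icc y))
  have hz : (x (Fin.last m) - y (Fin.last m)) *
      (1 + logInterpSlope K L s t (1 - sinMax y ^ 2)) = 0 := by
    linear_combination hn - hsub
  ext j
  refine Fin.lastCases ?_ hi j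
  rcases mul_eq_zero.1 hz with h | h <;> linarith [hs.1]

theorem smul_single_last_one {m : ℕ} (r : ℝ) :
    r • (EuclideanSpace.single (Fin.last m) 1 : EuclideanSpace ℝ (Fin (m + 1))) =
      EuclideanSpace.single (Fin.last m) r := by
  ext j
  simp

theorem hasFDerivAt_verticalInterp {m : ℕ} {K L s t : ℝ} {x : EuclideanSpace ℝ (Fin (m + 1))}
    {l : EuclideanSpace ℝ (Fin (m + 1)) →L[ℝ] ℝ}
    (hl : HasFDerivAt (fun x : EuclideanSpace ℝ (Fin (m + 1)) =>
      logInterp K L s t (x (Fin.last m)) (1 - sinMax x ^ 2)) l x) :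
    HasFDerivAt (verticalInterp K L s t)
      (ContinuousLinearMap.id ℝ (EuclideanSpace ℝ (Fin (m + 1))) +
        l.smulRight (EuclideanSpace.single (Fin.last m) 1)) x := by
  have h : verticalInterp (m := m) K L s t = fun x => x +
      logInterp K L s t (x (Fin.last m)) (1 - sinMax x ^ 2) •
        EuclideanSpace.single (Fin.last m) (1 : ℝ) := by
    funext x; rw [verticalInterp, smul_single_last_one]
  rw [h]
  exact (hasFDerivAt_id x).add (hl.smul_const _)

/-- `sinMax` is independent of `x_n`, so the vertical component of any derivative of the exponent is
known, without knowing where `sinMax` is differentiable. -/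
theorem fderiv_exponent_single_last {m : ℕ} {K L s t : ℝ} (hst : s < t)
    {x : EuclideanSpace ℝ (Fin (m + 1))} {l : EuclideanSpace ℝ (Fin (m + 1)) →L[ℝ] ℝ}
    (hl : HasFDerivAt (fun x : EuclideanSpace ℝ (Fin (m + 1)) =>
      logInterp K L s t (x (Fin.last m)) (1 - sinMax x ^ 2)) l x) :
    l (EuclideanSpace.single (Fin.last m) 1) = logInterpSlope K L s t (1 - sinMax x ^ 2) := by
  have h₁ := hl.hasLineDerivAt (EuclideanSpace.single (Fin.last m) 1)
  refine HasDerivAt.unique h₁ ?_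
  have e : (fun r : ℝ => logInterp K L s t
        ((x + r • EuclideanSpace.single (Fin.last m) (1 : ℝ)) (Fin.last m))
        (1 - sinMax (x + r • EuclideanSpace.single (Fin.last m) (1 : ℝ)) ^ 2)) =
      fun r => logInterp K L s t (x (Fin.last m)) (1 - sinMax x ^ 2) +
        logInterpSlope K L s t (1 - sinMax x ^ 2) * r := by
    funext r
    rw [smul_single_last_one, sinMax_add_single_last, add_single_last_last]
    have := logInterp_sub hst K L (x (Fin.last m) + r) (x (Fin.last m)) (1 - sinMax x ^ 2)
    linear_combination this
  rw [e]
  simpa using ((hasDerivAt_id (0 : ℝ)).const_mul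
    (logInterpSlope K L s t (1 - sinMax x ^ 2))).const_add
      (logInterp K L s t (x (Fin.last m)) (1 - sinMax x ^ 2))

theorem norm_single_last_one (m : ℕ) :
    ‖(EuclideanSpace.single (Fin.last m) 1 : EuclideanSpace ℝ (Fin (m + 1)))‖ = 1 := by simp

/-- Rademacher's theorem for the exponent gives `‖l‖ ≤ D` almost everywhere, while `l(e_n)` is the
slope, at least `-1/2`. -/
theorem isQuasiconformalOn_verticalInterp {m : ℕ} {K L s t : ℝ} (hst : s < t)
    (ha : ∀ q ∈ Icc (0 : ℝ) 1, |logInterpSlope K L s t q| ≤ 1 / 2)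
    {V : Set (EuclideanSpace ℝ (Fin (m + 1)))} (hV : IsOpen V) (hVc : IsConnected V) {D : ℝ≥0}
    (hD : LipschitzOnWith D (fun x : EuclideanSpace ℝ (Fin (m + 1)) =>
      logInterp K L s t (x (Fin.last m)) (1 - sinMax x ^ 2)) V) :
    IsQuasiconformalOn (verticalInterp K L s t) V := by
  refine ⟨.of_locallyLipschitzOn (C := 2 * (1 + D) ^ (m + 1)) hV hVc ?_ ?_ ?_,
    (verticalInterp_injective hst ha).injOn⟩
  · have hlip : LipschitzOnWith (1 + D) (verticalInterp K L s t) V := by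
      refine LipschitzOnWith.of_dist_le_mul fun x hx y hy => ?_
      have h := hD.dist_le_mul x hx y hy
      refine (dist_add_add_le _ _ _ _).trans ?_
      rw [PiLp.dist_single_same]
      push_cast
      linarith
    exact fun x hx => ⟨1 + D, V, self_mem_nhdsWithin, hlip⟩
  · have : (1 : ℝ) ≤ (1 + D) ^ (m + 1) := one_le_pow₀ (by simp)
    linarith
  · refine (ae_restrict_iff' hV.measurableSet).2 ?_
    filter_upwards [hD.ae_differentiableWithinAt_of_mem (μ := volume)] with x hx hxV
    have hdiff := ((hx hxV).differentiableAt (hV.mem_nhds hxV)).hasFDerivAt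
    have hn := norm_fderiv_le_of_lipschitzOn ℝ (hV.mem_nhds hxV) hD
    have hl := fderiv_exponent_single_last hst hdiff
    rw [(hasFDerivAt_verticalInterp hdiff).fderiv]
    have := ContinuousLinearMap.norm_pow_le_mul_det_of_rank_one (c := 1) (B := D) zero_le_one
      _ (EuclideanSpace.single (Fin.last m) 1) (by rwa [norm_single_last_one, mul_one])
      (by rw [hl]; exact (abs_le.1 (ha _ (one_sub_sinMax_sq_mem_Icc x))).1)
    simpa only [one_smul] using this

theorem lipschitzOnWith_exponent {m : ℕ} {K L s t : ℝ} (hK : 1 ≤ K) (hL : 1 ≤ L) (hst : s < t)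
    (ha : ∀ q ∈ Icc (0 : ℝ) 1, |logInterpSlope K L s t q| ≤ 1 / 2) :
    LipschitzOnWith (Real.toNNReal (1 / 2 + (K ^ 2 + L ^ 2)))
      (fun x : EuclideanSpace ℝ (Fin (m + 1)) =>
        logInterp K L s t (x (Fin.last m)) (1 - sinMax x ^ 2))
      {x | s ≤ x (Fin.last m) ∧ x (Fin.last m) ≤ t} := by
  refine LipschitzOnWith.of_dist_le_mul fun x _ y hy => ?_
  rw [Real.coe_toNNReal _ (by positivity), Real.dist_eq, dist_eq_norm]
  -- The height is changed first, at fixed `q`; then `q` is changed at the height of `y`, which lies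
  -- in `[s, t]`.
  have h₁ := logInterp_sub hst K L (x (Fin.last m)) (y (Fin.last m)) (1 - sinMax x ^ 2)
  have h₂ := abs_logInterp_sub_le hK hL hst hy (one_sub_sinMax_sq_mem_Icc x)
    (one_sub_sinMax_sq_mem_Icc y)
  have h₃ := abs_sinMax_sq_sub_le x y
  have h₄ := abs_coord_le_norm (x - y) (Fin.last m)
  have h₅ : |logInterp K L s t (x (Fin.last m)) (1 - sinMax x ^ 2) -
      logInterp K L s t (y (Fin.last m)) (1 - sinMax x ^ 2)| ≤ 1 / 2 * ‖x - y‖ := by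
    rw [h₁, abs_mul]
    exact mul_le_mul (ha _ (one_sub_sinMax_sq_mem_Icc x)) h₄ (abs_nonneg _) (by norm_num)
  calc _ ≤ _ := abs_sub_le _ (logInterp K L s t (y (Fin.last m)) (1 - sinMax x ^ 2)) _
    _ ≤ 1 / 2 * ‖x - y‖ + (K ^ 2 + L ^ 2) / 2 * (2 * ‖x - y‖) :=
      add_le_add h₅ (h₂.trans (by gcongr))
    _ = _ := by ring

theorem lipschitzWith_exponent_self {m : ℕ} {K : ℝ} (hK : 1 ≤ K) :
    LipschitzWith (Real.toNNReal (K ^ 2)) (fun x : EuclideanSpace ℝ (Fin (m + 1)) =>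
      logInterp K K 0 1 (x (Fin.last m)) (1 - sinMax x ^ 2)) := by
  refine LipschitzWith.of_dist_le_mul fun x y => ?_
  rw [Real.coe_toNNReal _ (by positivity), Real.dist_eq, dist_eq_norm, logInterp_self zero_lt_one,
    logInterp_self zero_lt_one]
  refine (abs_logStretch_sub_le hK (one_sub_sinMax_sq_mem_Icc x)
    (one_sub_sinMax_sq_mem_Icc y)).trans ?_
  calc _ ≤ K ^ 2 / 2 * (2 * ‖x - y‖) := by gcongr; exact abs_sinMax_sq_sub_le x y
    _ = _ := by ring

/-! ### The linear distortion on the pyramids -/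

/-- The inverse is `I - (1 + l w)⁻¹ w ⊗ l` (Sherman–Morrison), and `1 + l w ≥ 1/2` bounds its norm
by `1 + 2N`. -/
theorem HasLinearDistortionLE.of_rank_one {n : ℕ}
    {F : EuclideanSpace ℝ (Fin n) → EuclideanSpace ℝ (Fin n)} {x w : EuclideanSpace ℝ (Fin n)}
    {l : EuclideanSpace ℝ (Fin n) →L[ℝ] ℝ} {N H : ℝ}
    (hF : HasFDerivAt F (ContinuousLinearMap.id ℝ (EuclideanSpace ℝ (Fin n)) + l.smulRight w) x)
    (hw : ‖w‖ ≤ 1) (hl : -(1 / 2) ≤ l w) (hN : ‖l‖ ≤ N) (hH : (1 + N) * (1 + 2 * N) ≤ H) :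
    HasLinearDistortionLE F x H := by
  have hpos : 0 < 1 + l w := by linarith
  have hN0 : 0 ≤ N := (norm_nonneg _).trans hN
  let A := ContinuousLinearEquiv.equivOfInverse
    (ContinuousLinearMap.id ℝ (EuclideanSpace ℝ (Fin n)) + l.smulRight w)
    (ContinuousLinearMap.id ℝ (EuclideanSpace ℝ (Fin n)) + (-(1 + l w)⁻¹ • l).smulRight w)
    (fun v => by
      simp only [add_apply, ContinuousLinearMap.id_apply,
        ContinuousLinearMap.smulRight_apply, smul_apply, map_add, map_smul,
        smul_eq_mul]
      have : l v + -(1 + l w)⁻¹ * (l v + l v * l w) = 0 := by field_simp; ring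
      linear_combination (norm := module) this • w)
    (fun v => by
      simp only [add_apply, ContinuousLinearMap.id_apply,
        ContinuousLinearMap.smulRight_apply, smul_apply, map_add, map_smul,
        smul_eq_mul]
      have : -(1 + l w)⁻¹ * l v + (l v + -(1 + l w)⁻¹ * l v * l w) = 0 := by field_simp; ring
      linear_combination (norm := module) this • w)
  refine ⟨A, hF, le_trans (mul_le_mul ?_ ?_ (norm_nonneg _) (by linarith)) hH⟩
  · refine (l.norm_id_add_smulRight_le w).trans ?_
    nlinarith [mul_le_mul hN hw (norm_nonneg _) hN0]
  · refine ((-(1 + l w)⁻¹ • l).norm_id_add_smulRight_le w).trans ?_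
    have h₁ : (1 + l w)⁻¹ ≤ 2 := by
      rw [inv_le_comm₀ hpos two_pos]; linarith
    rw [norm_smul, norm_neg, norm_inv, Real.norm_of_nonneg hpos.le]
    have h₂ := mul_le_mul h₁ hN (norm_nonneg _) zero_le_two
    nlinarith [mul_le_mul h₂ hw (norm_nonneg _) (by linarith : 0 ≤ 2 * N)]

/-- With `q = K² + L² ≥ 2` one has `√(q + 1) ≤ q`, and the square of the first factor is `5/4 + q/4
+ √(q + 1) ≤ 5/4 + q² + 3q`. -/
theorem le_distortionBound {K L : ℝ} (hK : 1 ≤ K) (hL : 1 ≤ L) :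
    (1 + √(K ^ 2 + L ^ 2 + 1) / 2) * (1 + 2 * (√(K ^ 2 + L ^ 2 + 1) / 2)) ≤
      distortionBound K L := by
  have hq : 2 ≤ K ^ 2 + L ^ 2 := by nlinarith
  rw [distortionBound, add_assoc 1 (K ^ 2)]
  set q := K ^ 2 + L ^ 2
  have h : √(q + 1) ≤ q := Real.sqrt_le_iff.2 ⟨by linarith, by nlinarith⟩
  have h' : 1 + √(q + 1) / 2 ≤ √(5 / 4 + q ^ 2 + 3 * q) :=
    Real.le_sqrt_of_sq_le (by nlinarith [Real.sqrt_nonneg (q + 1)])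
  exact mul_le_mul h' (by linarith) (by positivity) (by positivity)

theorem abs_sin_lt_abs_sin {m : ℕ} {i j : Fin m} {x : EuclideanSpace ℝ (Fin (m + 1))}
    (h : |foldedCoords x j| < |foldedCoords x i|) :
    |Real.sin (x j.castSucc)| < |Real.sin (x i.castSucc)| := by
  rw [foldedCoords, foldedCoords, abs_reflectFold, abs_reflectFold] at h
  exact Real.monotone_arcsin.reflect_lt h

theorem sinMax_eventuallyEq_of_mem_pyramid {m : ℕ} {i : Fin m}
    {x : EuclideanSpace ℝ (Fin (m + 1))} (hx : x ∈ pyramid i) :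
    ∀ᶠ y in 𝓝 x, sinMax y = |Real.sin (y i.castSucc)| := by
  have h : ∀ᶠ y : EuclideanSpace ℝ (Fin (m + 1)) in 𝓝 x, ∀ j : Fin m, j ≠ i →
      |Real.sin (y j.castSucc)| < |Real.sin (y i.castSucc)| := by
    refine Filter.eventually_all.2 fun j => ?_
    by_cases hj : j = i
    · exact .of_forall fun y hy => absurd hj hy
    · refine (ContinuousAt.eventually_lt (by fun_prop) (by fun_prop)
        (abs_sin_lt_abs_sin (i := i) (j := j) (x := x) (hx.2 j hj))).mono fun y hy _ => hy
  filter_upwards [h] with y hy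
  refine le_antisymm ((pi_norm_le_iff_of_nonneg (abs_nonneg _)).2 fun j => ?_)
    (norm_le_pi_norm (fun i : Fin m => Real.sin (y i.castSucc)) i)
  by_cases hj : j = i
  · rw [hj, Real.norm_eq_abs]
  · exact (hy j hj).le

/-- `H₁` and `H₂` are kept apart from `K` and `L` because the single stretch is the interpolation
with `K = L`, yet its bound is `H(K, 1)`. -/
theorem hasLinearDistortionLE_verticalInterp {m : ℕ} {K L s t H₁ H₂ : ℝ} (hK : 1 ≤ K) (hL : 1 ≤ L)
    (hst : s < t) (h₁ : 1 ≤ H₁) (h₂ : 1 ≤ H₂)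
    (ha : ∀ q ∈ Icc (0 : ℝ) 1, |logInterpSlope K L s t q| ≤ 1 / 2) {i : Fin m}
    {x : EuclideanSpace ℝ (Fin (m + 1))} (hx : x ∈ pyramid i)
    (hb : (logInterpDeriv K L s t (x (Fin.last m)) (Real.cos (x i.castSucc) ^ 2) *
      (2 * Real.cos (x i.castSucc) * Real.sin (x i.castSucc))) ^ 2 ≤ (H₁ ^ 2 + H₂ ^ 2) / 4) :
    HasLinearDistortionLE (verticalInterp K L s t) x (distortionBound H₁ H₂) := by
  let pn : EuclideanSpace ℝ (Fin (m + 1)) →L[ℝ] ℝ := EuclideanSpace.proj (Fin.last m)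
  let pi : EuclideanSpace ℝ (Fin (m + 1)) →L[ℝ] ℝ := EuclideanSpace.proj i.castSucc
  have hpn : HasFDerivAt (fun x : EuclideanSpace ℝ (Fin (m + 1)) => x (Fin.last m)) pn x :=
    pn.hasFDerivAt
  have hpi : HasFDerivAt (fun x : EuclideanSpace ℝ (Fin (m + 1)) => x i.castSucc) pi x :=
    pi.hasFDerivAt
  have hev := sinMax_eventuallyEq_of_mem_pyramid hx
  have hq : HasFDerivAt (fun x : EuclideanSpace ℝ (Fin (m + 1)) => 1 - sinMax x ^ 2)
      (-(2 * Real.cos (x i.castSucc) * Real.sin (x i.castSucc)) • pi) x := by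
    have h : HasFDerivAt (fun x : EuclideanSpace ℝ (Fin (m + 1)) => Real.cos (x i.castSucc) ^ 2)
        (-(2 * Real.cos (x i.castSucc) * Real.sin (x i.castSucc)) • pi) x := by
      refine (hpi.cos.pow 2).congr_fderiv ?_
      ext v
      simp [pi]
      ring
    -- Squaring removes the kink of `|sin x_i|` at `x_i = 0`, a point which lies in the pyramid when
    -- `m = 1`.
    refine h.congr_of_eventuallyEq ?_
    filter_upwards [hev] with y hy
    rw [hy, sq_abs, Real.cos_sq']
  have hqx : 1 - sinMax x ^ 2 = Real.cos (x i.castSucc) ^ 2 := by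
    rw [hev.self_of_nhds, sq_abs, Real.cos_sq']
  have hg := hasFDerivAt_logInterp (K := K) (L := L) hK hL hst hpn hq (one_sub_sinMax_sq_mem_Icc x)
  have hlw := fderiv_exponent_single_last hst hg
  have ha' := ha _ (one_sub_sinMax_sq_mem_Icc x)
  refine .of_rank_one (hasFDerivAt_verticalInterp hg) (norm_single_last_one m).le
    (by rw [hlw]; exact (abs_le.1 ha').1) ?_ (le_distortionBound h₁ h₂)
  refine ContinuousLinearMap.opNorm_le_bound _ (by positivity) fun v => ?_
  set a := logInterpSlope K L s t (1 - sinMax x ^ 2)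
  rw [hqx]
  set b := logInterpDeriv K L s t (x (Fin.last m)) (Real.cos (x i.castSucc) ^ 2) *
      (2 * Real.cos (x i.castSucc) * Real.sin (x i.castSucc)) with hbdef
  have e : (a • pn + logInterpDeriv K L s t (x (Fin.last m)) (Real.cos (x i.castSucc) ^ 2) •
      -(2 * Real.cos (x i.castSucc) * Real.sin (x i.castSucc)) • pi) v =
      a * v (Fin.last m) - b * v i.castSucc := by
    simp [pn, pi, hbdef]
    ring
  rw [e, Real.norm_eq_abs]
  refine abs_le_of_sq_le_sq ?_ (by positivity)
  have hv : v i.castSucc ^ 2 + v (Fin.last m) ^ 2 ≤ ‖v‖ ^ 2 := by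
    rw [EuclideanSpace.real_norm_sq_eq, Fin.sum_univ_castSucc]
    gcongr
    exact Finset.single_le_sum (f := fun j : Fin m => v j.castSucc ^ 2)
      (fun j _ => sq_nonneg _) (Finset.mem_univ i)
  have ha2 : a ^ 2 ≤ 1 / 4 := by
    rw [← sq_abs]
    exact (pow_le_pow_left₀ (abs_nonneg _) ha' 2).trans (by norm_num)
  rw [mul_pow, div_pow, Real.sq_sqrt (by positivity)]
  -- Cauchy–Schwarz, with `a² ≤ 1/4` from the slope and `b² ≤ (H₁² + H₂²) / 4`.
  calc (a * v (Fin.last m) - b * v i.castSucc) ^ 2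
      ≤ (a ^ 2 + b ^ 2) * (v i.castSucc ^ 2 + v (Fin.last m) ^ 2) := by
        nlinarith [sq_nonneg (a * v i.castSucc + b * v (Fin.last m))]
    _ ≤ (H₁ ^ 2 + H₂ ^ 2 + 1) / 2 ^ 2 * ‖v‖ ^ 2 := by
        gcongr
        linarith

theorem HasLinearDistortionLE.congr_of_eventuallyEq {n : ℕ}
    {F G : EuclideanSpace ℝ (Fin n) → EuclideanSpace ℝ (Fin n)} {x : EuclideanSpace ℝ (Fin n)}
    {H : ℝ} (hF : HasLinearDistortionLE F x H) (h : G =ᶠ[𝓝 x] F) : HasLinearDistortionLE G x H := by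
  obtain ⟨A, hA, hH⟩ := hF
  exact ⟨A, hA.congr_of_eventuallyEq h, hH⟩

theorem zorichTransform_eventuallyEq {m : ℕ} [NeZero m] {K L s t : ℝ} (hK : 1 ≤ K) (hL : 1 ≤ L)
    (hst : s < t) {x : EuclideanSpace ℝ (Fin (m + 1))} (hx : x ∈ interior (zorichDomain m)) :
    zorichTransform (radialInterp K L s t) =ᶠ[𝓝 x] verticalInterp K L s t := by
  filter_upwards [isOpen_interior.mem_nhds hx] with y hy
  exact zorichTransform_radialInterp hK hL hst (interior_subset hy)

/-- The statements about the radial stretch and its Zorich transform. -/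
theorem radialStretch_properties {m : ℕ} [NeZero m] {K : ℝ} (hK : 1 ≤ K) :
    IsQuasiconformalOn (radialStretch (m := m) K) univ ∧
      (∀ x ∈ zorichDomain m,
        zorichTransform (radialStretch K) x ∈ zorichDomain m ∧
        zorichMap (zorichTransform (radialStretch K) x) = radialStretch K (zorichMap x) ∧
        zorichTransform (radialStretch K) x =
          x + EuclideanSpace.single (Fin.last m) (Real.log (stretchFactor K (coordMax x)))) ∧
      (∀ i : Fin m, ∀ x ∈ pyramid i,
        HasLinearDistortionLE (zorichTransform (radialStretch K)) x (distortionBound K 1)) ∧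
      IsQuasiconformalOn (zorichTransform (radialStretch (m := m) K))
        (interior (zorichDomain m)) := by
  refine ⟨isQuasiconformalOn_radialStretch hK, ?_⟩
  have hst : (0 : ℝ) < 1 := zero_lt_one
  have ha : ∀ q ∈ Icc (0 : ℝ) 1, |logInterpSlope K K 0 1 q| ≤ 1 / 2 :=
    fun q _ => by rw [logInterpSlope_self]; norm_num
  rw [radialStretch_eq_radialInterp hK]
  refine ⟨fun x hx => ?_, fun i x hx => ?_, ?_⟩
  · rw [zorichTransform_radialInterp hK hK hst hx]
    refine ⟨add_single_last_mem_zorichDomain hx _, zorichMap_verticalInterp hK hK hst hx, ?_⟩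
    rw [verticalInterp, logInterp_self hst, log_stretchFactor_coordMax hK]
  · refine (hasLinearDistortionLE_verticalInterp hK hK hst hK le_rfl ha hx ?_).congr_of_eventuallyEq
      (zorichTransform_eventuallyEq hK hK hst hx.1)
    -- For a single stretch the square is at most `K² / 4 ≤ (K² + 1) / 4`, which allows `H₂ = 1`.
    rw [logInterpDeriv_self hst, ← sq_abs, abs_mul, abs_of_nonneg
      (logStretchDeriv_nonneg hK ⟨sq_nonneg _, Real.cos_sq_le_one _⟩)]
    have h := pow_le_pow_left₀ (mul_nonneg (logStretchDeriv_nonneg hK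
      ⟨sq_nonneg _, Real.cos_sq_le_one _⟩) (abs_nonneg _))
      (abs_logStretchDeriv_mul_le hK (x i.castSucc)) 2
    linarith
  · have h := isQuasiconformalOn_verticalInterp hst ha (V := interior (zorichDomain m))
      isOpen_interior (by
      have := isConnected_zorichBox_inter (m := m) convex_univ univ_nonempty
      rw [interior_zorichDomain m]
      simpa using this) (lipschitzWith_exponent_self hK).lipschitzOnWith
    have he : EqOn (zorichTransform (radialInterp K K 0 1)) (verticalInterp K K 0 1)
        (interior (zorichDomain m)) := fun x hx =>
      zorichTransform_radialInterp hK hK hst (interior_subset hx)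
    exact ⟨h.1.congr he, h.2.congr he.symm⟩

/-- The statements about the interpolation map and its Zorich transform. -/
theorem radialInterp_properties {m : ℕ} [NeZero m] {K L s t : ℝ} (hK : 1 ≤ K) (hL : 1 ≤ L)
    (hst : s < t) (hKL : |Real.log (K / L)| < (t - s) / 2) :
    ContinuousOn (radialInterp (m := m) K L s t)
        {y | Real.exp s ≤ ‖y‖ ∧ ‖y‖ ≤ Real.exp t} ∧
      InjOn (radialInterp (m := m) K L s t) {y | Real.exp s ≤ ‖y‖ ∧ ‖y‖ ≤ Real.exp t} ∧
      IsQuasiconformalOn (radialInterp (m := m) K L s t)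
        {y | Real.exp s < ‖y‖ ∧ ‖y‖ < Real.exp t} ∧
      (∀ y : EuclideanSpace ℝ (Fin (m + 1)), ‖y‖ = Real.exp s →
        radialInterp K L s t y = radialStretch L y) ∧
      (∀ y : EuclideanSpace ℝ (Fin (m + 1)), ‖y‖ = Real.exp t →
        radialInterp K L s t y = radialStretch K y) ∧
      (∀ x ∈ zorichDomain m, s ≤ x (Fin.last m) → x (Fin.last m) ≤ t →
        zorichTransform (radialInterp K L s t) x ∈ zorichDomain m ∧
        zorichMap (zorichTransform (radialInterp K L s t) x) =
          radialInterp K L s t (zorichMap x) ∧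
        zorichTransform (radialInterp K L s t) x =
          x + EuclideanSpace.single (Fin.last m)
            (Real.log (stretchFactor K (coordMax x)) * ((x (Fin.last m) - s) / (t - s)) +
              Real.log (stretchFactor L (coordMax x)) * ((x (Fin.last m) - t) / (s - t)))) ∧
      (∀ i : Fin m, ∀ x ∈ pyramid i, s < x (Fin.last m) → x (Fin.last m) < t →
        HasLinearDistortionLE (zorichTransform (radialInterp K L s t)) x
          (distortionBound K L)) ∧
      IsQuasiconformalOn (zorichTransform (radialInterp (m := m) K L s t))
        (interior (zorichDomain m) ∩ {x | s < x (Fin.last m) ∧ x (Fin.last m) < t}) := by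
  have ha : ∀ q ∈ Icc (0 : ℝ) 1, |logInterpSlope K L s t q| ≤ 1 / 2 :=
    fun q hq => abs_logInterpSlope_le hK hL hst hKL hq
  refine ⟨fun y hy => ?_, (radialInterp_injective hK hL hst ha).injOn,
    isQuasiconformalOn_radialInterp (NeZero.one_le (n := m)) hK hL hst hKL,
    fun y hy => radialInterp_of_norm_eq_left hy, fun y hy => radialInterp_of_norm_eq_right hst hy,
    fun x hx _ _ => ?_, fun i x hx hs ht => ?_, ?_⟩
  · have hy0 : y ≠ 0 := norm_pos_iff.1 ((Real.exp_pos s).trans_le hy.1)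
    exact (contDiffAt_radialInterp hK hL hst hy0).continuousAt.continuousWithinAt
  · rw [zorichTransform_radialInterp hK hL hst hx]
    refine ⟨add_single_last_mem_zorichDomain hx _, zorichMap_verticalInterp hK hL hst hx, ?_⟩
    rw [verticalInterp, logInterp, log_stretchFactor_coordMax hK, log_stretchFactor_coordMax hL]
  · exact (hasLinearDistortionLE_verticalInterp hK hL hst hK hL ha hx
      (sq_logInterpDeriv_mul_le hK hL hst ⟨hs.le, ht.le⟩ _)).congr_of_eventuallyEq
      (zorichTransform_eventuallyEq hK hL hst hx.1)
  · have hopen : IsOpen {x : EuclideanSpace ℝ (Fin (m + 1)) |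
        s < x (Fin.last m) ∧ x (Fin.last m) < t} :=
      isOpen_Ioo.preimage (by fun_prop : Continuous fun x : EuclideanSpace ℝ (Fin (m + 1)) =>
        x (Fin.last m))
    have h := isQuasiconformalOn_verticalInterp hst ha (V := interior (zorichDomain m) ∩ _)
      (isOpen_interior.inter hopen) (by
      rw [interior_zorichDomain m]
      exact isConnected_zorichBox_inter (convex_Ioo s t) (nonempty_Ioo.2 hst))
      ((lipschitzOnWith_exponent hK hL hst ha).mono fun x hx => ⟨hx.2.1.le, hx.2.2.le⟩)
    have he : EqOn (zorichTransform (radialInterp K L s t)) (verticalInterp K L s t)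
        (interior (zorichDomain m) ∩ {x | s < x (Fin.last m) ∧ x (Fin.last m) < t}) := fun x hx =>
      zorichTransform_radialInterp hK hL hst (interior_subset hx.1)
    exact ⟨h.1.congr he, h.2.congr he.symm⟩

theorem mainTheorem5 (m : ℕ) (hm : 1 ≤ m) :
    (∀ K : ℝ, 1 ≤ K →
      IsQuasiconformalOn (radialStretch (m := m) K) univ ∧
      (∀ x ∈ zorichDomain m,
        zorichTransform (radialStretch K) x ∈ zorichDomain m ∧
        zorichMap (zorichTransform (radialStretch K) x) = radialStretch K (zorichMap x) ∧
        zorichTransform (radialStretch K) x =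
          x + EuclideanSpace.single (Fin.last m) (Real.log (stretchFactor K (coordMax x)))) ∧
      (∀ i : Fin m, ∀ x ∈ pyramid i,
        HasLinearDistortionLE (zorichTransform (radialStretch K)) x (distortionBound K 1)) ∧
      IsQuasiconformalOn (zorichTransform (radialStretch (m := m) K))
        (interior (zorichDomain m))) ∧
    (∀ K L s t : ℝ, 1 ≤ K → 1 ≤ L → s < t → |Real.log (K / L)| < (t - s) / 2 →
      ContinuousOn (radialInterp (m := m) K L s t)
        {y | Real.exp s ≤ ‖y‖ ∧ ‖y‖ ≤ Real.exp t} ∧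
      InjOn (radialInterp (m := m) K L s t) {y | Real.exp s ≤ ‖y‖ ∧ ‖y‖ ≤ Real.exp t} ∧
      IsQuasiconformalOn (radialInterp (m := m) K L s t)
        {y | Real.exp s < ‖y‖ ∧ ‖y‖ < Real.exp t} ∧
      (∀ y : EuclideanSpace ℝ (Fin (m + 1)), ‖y‖ = Real.exp s →
        radialInterp K L s t y = radialStretch L y) ∧
      (∀ y : EuclideanSpace ℝ (Fin (m + 1)), ‖y‖ = Real.exp t →
        radialInterp K L s t y = radialStretch K y) ∧
      (∀ x ∈ zorichDomain m, s ≤ x (Fin.last m) → x (Fin.last m) ≤ t →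
        zorichTransform (radialInterp K L s t) x ∈ zorichDomain m ∧
        zorichMap (zorichTransform (radialInterp K L s t) x) =
          radialInterp K L s t (zorichMap x) ∧
        zorichTransform (radialInterp K L s t) x =
          x + EuclideanSpace.single (Fin.last m)
            (Real.log (stretchFactor K (coordMax x)) * ((x (Fin.last m) - s) / (t - s)) +
              Real.log (stretchFactor L (coordMax x)) * ((x (Fin.last m) - t) / (s - t)))) ∧
      (∀ i : Fin m, ∀ x ∈ pyramid i, s < x (Fin.last m) → x (Fin.last m) < t →
        HasLinearDistortionLE (zorichTransform (radialInterp K L s t)) x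
          (distortionBound K L)) ∧
      IsQuasiconformalOn (zorichTransform (radialInterp (m := m) K L s t))
        (interior (zorichDomain m) ∩ {x | s < x (Fin.last m) ∧ x (Fin.last m) < t})) :=
  haveI : NeZero m := ⟨by omega⟩
  ⟨fun _ hK => radialStretch_properties hK,
    fun _ _ _ _ hK hL hst hKL => radialInterp_properties hK hL hst hKL⟩
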